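/- For $|q|<1$ let $$P(q)=1-24\sum_{n\ge1}\frac{nq^n}{1-q^n},\qquad Q(q)=1+240\sum_{n\ge1}\frac{n^3q^n}{1-q^n},\qquad R(q)=1-504\sum_{n\ge1}\frac{n^5q^n}{1-q^n}.$$ Let ${}_2F_1(a,b;c;\cdot)$ denote the principal branch of the hypergeometric function, i.e. the holomorphic continuation of the hypergeometric series to $\mathbb{C}\setminus[1,\infty)$ (which exists for the parameters used here). On $U=\mathbb{C}\setminus((-\infty,0]\cup[1,\infty))$ put $$\chi_1(s)={}_2F_1(\tfrac1{12},\tfrac5{12};1;s),\qquad \chi_2(s)=A\,{}_2F_1(\tfrac1{12},\tfrac5{12};\tfrac12;1-s)+B\,\chi_1(s),\qquad z(s)=\frac{\chi_2(s)}{\chi_1(s)},$$ where $A=\frac{i}{2\pi}\frac{\Gamma(1/12)\Gamma(5/12)}{\Gamma(1/2)}$ and $B=-i$. Then $z(s)$ is normalized by $\operatorname{Im} z(s)\to+\infty$ as $s\to0$ and $z(s)\to i$ as $s\to1$ (within $U$). For every $s\in U$ one has $\chi_1(s)\ne0$ and $\operatorname{Im}z(s)>0$, and with $q=e^{2\pi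 i z(s)}$ (so $|q|<1$) and the principal square root, $$P(q)=(1-s)^{1/2}\bigl(\chi_1^2+12s\chi_1\chi_1'\bigr),\qquad Q(q)=\chi_1^4,\qquad R(q)=(1-s)^{1/2}\chi_1^6,$$ where $\chi_1=\chi_1(s)$, $\chi_1'=\chi_1'(s)$; hence $s=(Q(q)^3-R(q)^2)/Q(q)^3$. Moreover, $\chi_1,\chi_2$ are linearly independent solutions on $U$ of the hypergeometric equation $$\chi''+\Big(\frac{1-\alpha}{s}+\frac{1-\beta}{s-1}\Big)\chi'+\frac{(\alpha+\beta-1)^2-\gamma^2}{4s(s-1)}\chi=0$$ with exponent differences $(\alpha,\beta,\gamma)=(0,\tfrac12,\tfrac13)$, and the inverse of $z(s)$ extends to a unique meromorphic function on the upper half-plane, the Schwarz triangle function $S(0,\tfrac12,\tfrac13;z)$, so that $S(0,\tfrac12,\tfrac13;z(s))=s$ for $s\in U$. As meromorphic functions on $\operatorname{Im}z>0$, with $q=e^{2\pi iz}$, $$S(0,\tfrac12,\tfrac13;z)=\frac{Q(q)^3-R(q)^2}{Q(q)^3}:$$ $S$ is analytic with this value wherever $Q(q)\ne0$, and it has a pole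 wherever $Q(q)=0$. -/

import Mathlib

open Complex Filter Topology

noncomputable section

/-- Ramanujan's function `P`. -/
def ramanujanP (q : ℂ) : ℂ := 1 - 24 * ∑' n : ℕ+, (n : ℂ) * q ^ (n : ℕ) / (1 - q ^ (n : ℕ))

/-- Ramanujan's function `Q`. -/
def ramanujanQ (q : ℂ) : ℂ := 1 + 240 * ∑' n : ℕ+, (n : ℂ) ^ 3 * q ^ (n : ℕ) / (1 - q ^ (n : ℕ))

/-- Ramanujan's function `R`. -/
def ramanujanR (q : ℂ) : ℂ := 1 - 504 * ∑' n : ℕ+, (n : ℂ) ^ 5 * q ^ (n : ℕ) / (1 - q ^ (n : ℕ))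

/-- `f` is the principal branch of the hypergeometric function with parameters `a, b; c`:
it is holomorphic on `ℂ ∖ [1, ∞)` and equals the sum of the hypergeometric series for `|s| < 1`.
By the identity theorem, `f` is unique on `ℂ ∖ [1, ∞)`. -/
structure IsHypergeometricBranch (a b c : ℂ) (f : ℂ → ℂ) : Prop where
  differentiableOn : DifferentiableOn ℂ f {s | 1 - s ∈ slitPlane}
  eq_series : ∀ s : ℂ, ‖s‖ < 1 → f s = ₂F₁ a b c s

open Classical in
/-- The principal branch of the hypergeometric function on `ℂ ∖ [1, ∞)`. -/
def hypergeometricBranch (a b c : ℂ) : ℂ → ℂ :=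
  if h : ∃ f, IsHypergeometricBranch a b c f then h.choose else 0

/-- The doubly cut plane `ℂ ∖ ((-∞, 0] ∪ [1, ∞))`. -/
def cutPlane : Set ℂ := {s | s ∈ slitPlane ∧ 1 - s ∈ slitPlane}

/-- `χ₁(s) = ₂F₁(1/12, 5/12; 1; s)`. -/
def chi₁ : ℂ → ℂ := hypergeometricBranch (1 / 12) (5 / 12) 1

/-- The constant `A`, fixed by `A Γ(1/2) / (Γ(1/12) Γ(5/12)) = i / (2π)`. -/
def constA : ℂ := I / (2 * Real.pi) * (Gamma (1 / 12) * Gamma (5 / 12) / Gamma (1 / 2))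

/-- The constant `B`. -/
def constB : ℂ := -I

/-- `χ₂(s) = A ₂F₁(1/12, 5/12; 1/2; 1 - s) + B χ₁(s)`. -/
def chi₂ (s : ℂ) : ℂ :=
  constA * hypergeometricBranch (1 / 12) (5 / 12) (1 / 2) (1 - s) + constB * chi₁ s

/-- The conformal map `z(s) = χ₂(s) / χ₁(s)`. -/
def zMap (s : ℂ) : ℂ := chi₂ s / chi₁ s

/-- `χ` is a holomorphic solution on the doubly cut plane of the hypergeometric equation with
exponent differences `α, β, γ` at `0, 1, ∞`. -/
def IsHypergeometricSolution (α β γ : ℂ) (χ : ℂ → ℂ) : Prop :=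
  DifferentiableOn ℂ χ cutPlane ∧ ∀ s ∈ cutPlane,
    deriv (deriv χ) s + ((1 - α) / s + (1 - β) / (s - 1)) * deriv χ s
      + ((α + β - 1) ^ 2 - γ ^ 2) / (4 * s * (s - 1)) * χ s = 0

/-- `S` is the Schwarz triangle function `S(α, β, γ; ·)` on the upper half-plane that belongs to
the ratio `χ₂ / χ₁` of two linearly independent solutions of the hypergeometric equation with
exponent differences `α, β, γ`: it is meromorphic on the whole upper half-plane, and it is the
inverse of that ratio. (Normal form: `S` is analytic except at its poles.) -/
structure IsTriangleFunction (α β γ : ℂ) (χ₁ χ₂ S : ℂ → ℂ) : Prop where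
  solution₁ : IsHypergeometricSolution α β γ χ₁
  solution₂ : IsHypergeometricSolution α β γ χ₂
  independent : ∀ s ∈ cutPlane, χ₁ s * deriv χ₂ s - χ₂ s * deriv χ₁ s ≠ 0
  meromorphic : MeromorphicNFOn S {z | 0 < z.im}
  mapsTo : ∀ s ∈ cutPlane, χ₁ s ≠ 0 ∧ 0 < (χ₂ s / χ₁ s).im
  inverse : ∀ s ∈ cutPlane, S (χ₂ s / χ₁ s) = s

end

/-! The heart of the matter is that, pulled back to the imaginary axis, the hypergeometric equation
becomes `L'' = 0`. At `z = iy` put `U = Q^{1/4}`, `W = R / Q^{3/2}` and `S = 1 - W²`. Ramanujan's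
differential equations for `P`, `Q`, `R`, which follow from the one-dimensionality of the spaces of
modular forms of weights 4, 6 and 8, imply that for every solution `φ` of the equation with
parameters `1/12, 5/12; 1` the quotient `φ(S(y)) / U(y)` is affine in `y` on `y > 1`
(`IsAxisSolution.exists_eq`). Boundary values fix the two coefficients. As `y → ∞`, both `χ₁(S)` and
`U` tend to 1, so `χ₁(S) = U`; as `y → 1`, the values `R(i) = 0` and `P(i) = 3/π` show that the even
solution at `s = 1` is `(1 + y) U / (2 U(1))`. Gauss's theorem evaluates `U(1)`, which gives `A = 2i
U(1)` and hence `z(S(y)) = iy` (`zMap_axisS`).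

The formulas for `P`, `Q`, `R` thus hold along a curve, and the identity theorem spreads them over
any connected set through that curve on which `χ₁ ≠ 0` and `Im z > 0`. That the whole cut plane is
such a set is a continuation argument (`closure_mainPart_inter_subset`). Suppose that the component
containing the curve had a limit point in the cut plane outside itself. There `z` or `-1/z` would
take a real value, and it would be a local coordinate because the Wronskian does not vanish. Its
inverse, holomorphic across the real line, would coincide with `(Q³ - R²)/Q³` on a half-disc. But
every real interval contains a cusp, where this modular function tends to `0`, and `0` is not in the
cut plane.

The normalization at `s = 0` and `s = 1` comes from inverting `(Q³ - R²)/Q³` as a function of `q` at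
`q = 0`, and its square root `R / Q^{3/2}` of `1 - s` as a function of `z` at `z = i`. Finally, `Q³
- R²` never vanishes, so the reciprocal of `(Q³ - R²)/Q³` is holomorphic on the upper half-plane;
this locates the poles, and the identity theorem for meromorphic functions gives uniqueness. -/

/-! ### Lambert series, Eisenstein series and their values at the cusp -/

section LambertSeries

open UpperHalfPlane hiding I
open ModularForm EisensteinSeries Derivative
open scoped MatrixGroups Manifold ArithmeticFunction.sigma

/-- The Lambert series `∑ nᵏ qⁿ / (1 - qⁿ)`. -/
noncomputable def lambertSeries (k : ℕ) (q : ℂ) : ℂ :=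
  ∑' n : ℕ+, (n : ℂ) ^ k * q ^ (n : ℕ) / (1 - q ^ (n : ℕ))

lemma summable_sigma_mul_pow (k : ℕ) {q : ℂ} (hq : ‖q‖ < 1) :
    Summable fun n : ℕ ↦ ‖(σ k n : ℂ) * q ^ n‖ := by
  refine Summable.of_nonneg_of_le (fun _ ↦ norm_nonneg _) (fun n ↦ ?_)
    (summable_norm_pow_mul_geometric_of_norm_lt_one (k + 1) hq)
  simp only [norm_mul, Complex.norm_natCast, norm_pow]
  gcongr
  exact_mod_cast ArithmeticFunction.sigma_le_pow_succ k n

lemma hasSum_lambertSeries (k : ℕ) {q : ℂ} (hq : ‖q‖ < 1) :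
    HasSum (fun n : ℕ ↦ (σ k n : ℂ) * q ^ n) (lambertSeries k q) := by
  have hs := (summable_sigma_mul_pow k hq).of_norm
  have h : lambertSeries k q = ∑' n : ℕ, (σ k n : ℂ) * q ^ n := by
    rw [lambertSeries, tsum_pow_div_one_sub_eq_tsum_sigma hq k,
      ← tsum_zero_pnat_eq_tsum_nat hs]
    simp
  rw [h]
  exact hs.hasSum

lemma hasFPowerSeriesOnBall_lambertSeries (k : ℕ) :
    HasFPowerSeriesOnBall (lambertSeries k) (.ofScalars ℂ fun n ↦ (σ k n : ℂ)) 0 1 where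
  r_le := by
    refine ENNReal.le_of_forall_nnreal_lt fun r hr ↦ ?_
    have hr' : ‖(r : ℂ)‖ < 1 := by simpa using hr
    refine FormalMultilinearSeries.le_radius_of_summable_norm _ ?_
    refine (summable_sigma_mul_pow k hr').congr fun n ↦ ?_
    simp
  r_pos := one_pos
  hasSum {y} hy := by
    have hy' : ‖y‖ < 1 := by
      rwa [← ENNReal.coe_one, Metric.eball_coe, NNReal.coe_one, mem_ball_zero_iff] at hy
    simpa [FormalMultilinearSeries.ofScalars_apply_eq, mul_comm] using hasSum_lambertSeries k hy'

lemma differentiableOn_lambertSeries (k : ℕ) :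
    DifferentiableOn ℂ (lambertSeries k) (Metric.ball 0 1) := by
  have := (hasFPowerSeriesOnBall_lambertSeries k).differentiableOn
  rwa [← ENNReal.coe_one, Metric.eball_coe] at this

lemma hasDerivAt_lambertSeries_zero (k : ℕ) : HasDerivAt (lambertSeries k) 1 0 := by
  simpa using (hasFPowerSeriesOnBall_lambertSeries k).hasFPowerSeriesAt.hasDerivAt

lemma lambertSeries_zero (k : ℕ) : lambertSeries k 0 = 0 := by
  simp [lambertSeries]

lemma ramanujanP_eq (q : ℂ) : ramanujanP q = 1 - 24 * lambertSeries 1 q := by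
  simp [ramanujanP, lambertSeries]

lemma ramanujanQ_eq (q : ℂ) : ramanujanQ q = 1 + 240 * lambertSeries 3 q := rfl

lemma ramanujanR_eq (q : ℂ) : ramanujanR q = 1 - 504 * lambertSeries 5 q := rfl

lemma norm_exp_two_pi_I_mul_lt_one {z : ℂ} (hz : 0 < z.im) : ‖exp (2 * Real.pi * I * z)‖ < 1 :=
  UpperHalfPlane.norm_exp_two_pi_I_lt_one ⟨z, hz⟩

lemma E2_eq_ramanujanP (z : ℍ) : E2 z = ramanujanP (exp (2 * Real.pi * I * z)) := by
  rw [E2_eq_tsum_cexp, ramanujanP_eq, lambertSeries,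
    tsum_pow_div_one_sub_eq_tsum_sigma (norm_exp_two_pi_I_lt_one z) 1]

lemma E₄_eq_ramanujanQ (z : ℍ) : E₄ z = ramanujanQ (exp (2 * Real.pi * I * z)) := by
  rw [EisensteinSeries.q_expansion_bernoulli _ ⟨2, rfl⟩, ramanujanQ_eq, lambertSeries,
    tsum_pow_div_one_sub_eq_tsum_sigma (norm_exp_two_pi_I_lt_one z) 3]
  rw [show bernoulli 4 = -1 / 30 by decide +kernel]
  norm_num

lemma E₆_eq_ramanujanR (z : ℍ) : E₆ z = ramanujanR (exp (2 * Real.pi * I * z)) := by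
  rw [EisensteinSeries.q_expansion_bernoulli _ ⟨3, rfl⟩, ramanujanR_eq, lambertSeries,
    tsum_pow_div_one_sub_eq_tsum_sigma (norm_exp_two_pi_I_lt_one z) 5]
  rw [show bernoulli 6 = 1 / 42 by decide +kernel]
  norm_num

lemma differentiableOn_ramanujanP : DifferentiableOn ℂ ramanujanP (Metric.ball 0 1) := by
  refine DifferentiableOn.congr ?_ fun q _ ↦ ramanujanP_eq q
  exact ((differentiableOn_lambertSeries 1).const_mul 24).const_sub 1

lemma differentiableOn_ramanujanQ : DifferentiableOn ℂ ramanujanQ (Metric.ball 0 1) :=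
  ((differentiableOn_lambertSeries 3).const_mul 240).const_add 1

lemma differentiableOn_ramanujanR : DifferentiableOn ℂ ramanujanR (Metric.ball 0 1) :=
  ((differentiableOn_lambertSeries 5).const_mul 504).const_sub 1

/-- The value at `i∞` of a function of `q = exp (2πiz)`. -/
lemma tendsto_comp_exp_atImInfty {f : ℂ → ℂ} (hf : ContinuousAt f 0) :
    Tendsto (fun z : ℍ ↦ f (exp (2 * Real.pi * I * z))) atImInfty (𝓝 (f 0)) := by
  have h := UpperHalfPlane.qParam_tendsto_atImInfty one_pos
  simp only [Function.Periodic.qParam, ofReal_one, div_one] at h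
  exact hf.tendsto.comp h

lemma continuousAt_zero_of_differentiableOn_ball {f : ℂ → ℂ}
    (hf : DifferentiableOn ℂ f (Metric.ball 0 1)) : ContinuousAt f 0 :=
  (hf.differentiableAt (Metric.ball_mem_nhds 0 one_pos)).continuousAt

lemma hasDerivAt_comp_exp {f : ℂ → ℂ} (hf : DifferentiableOn ℂ f (Metric.ball 0 1)) {z : ℂ}
    (hz : 0 < z.im) :
    HasDerivAt (fun z ↦ f (exp (2 * Real.pi * I * z)))
      (2 * Real.pi * I * (exp (2 * Real.pi * I * z) * deriv f (exp (2 * Real.pi * I * z)))) z := by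
  have h1 : HasDerivAt f (deriv f (exp (2 * Real.pi * I * z))) (exp (2 * Real.pi * I * z)) :=
    (hf.differentiableAt (Metric.isOpen_ball.mem_nhds
      (by simpa using norm_exp_two_pi_I_mul_lt_one hz))).hasDerivAt
  have h2 : HasDerivAt (fun z ↦ exp (2 * Real.pi * I * z))
      (exp (2 * Real.pi * I * z) * (2 * Real.pi * I)) z := by
    simpa using ((hasDerivAt_id z).const_mul (2 * Real.pi * I)).cexp
  exact (h1.comp z h2).congr_deriv (by ring)

/-- In the variable `q` the operator `D` is `q d/dq`, which kills the constant term. -/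
lemma tendsto_normalizedDeriv_atImInfty {F : ℍ → ℂ} {f : ℂ → ℂ}
    (hf : DifferentiableOn ℂ f (Metric.ball 0 1))
    (hF : ∀ z : ℍ, F z = f (exp (2 * Real.pi * I * z))) :
    Tendsto (D F) atImInfty (𝓝 0) := by
  have hD : D F = fun z : ℍ ↦
      exp (2 * Real.pi * I * z) * deriv f (exp (2 * Real.pi * I * z)) := by
    ext z
    have he : F ∘ ofComplex =ᶠ[𝓝 (z : ℂ)] fun z ↦ f (exp (2 * Real.pi * I * z)) := by
      filter_upwards [isOpen_upperHalfPlaneSet.mem_nhds z.im_pos] with w hw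
      simp [hF, ofComplex_apply_of_im_pos hw]
    rw [normalizedDerivOfComplex, he.deriv_eq, (hasDerivAt_comp_exp hf z.im_pos).deriv,
      inv_mul_cancel_left₀ two_pi_I_ne_zero]
  rw [hD]
  have hc : ContinuousAt (fun q ↦ q * deriv f q) 0 :=
    continuousAt_id.mul (continuousAt_zero_of_differentiableOn_ball (hf.deriv Metric.isOpen_ball))
  simpa using tendsto_comp_exp_atImInfty hc

/-- The modular form given by a holomorphic invariant function with a limit at `i∞`. -/
noncomputable def modularFormOfTendsto {k : ℤ} {f : ℍ → ℂ} {c : ℂ} (hf : MDiff f)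
    (hinv : ∀ γ : SL(2, ℤ), f ∣[k] γ = f) (hlim : Tendsto f atImInfty (𝓝 c)) :
    ModularForm 𝒮ℒ k where
  toFun := f
  slash_action_eq' := by
    rintro _ ⟨γ, rfl⟩
    exact hinv γ
  holo' := hf
  bdd_at_cusps' {c} hc := by
    rw [OnePoint.isBoundedAt_iff_forall_SL2Z hc]
    intro γ _
    rw [hinv γ]
    exact hlim.isBigO_one ℝ

/-- A form in a one-dimensional space is determined by its value at `i∞`. Each of Ramanujan's three
identities is reduced by this lemma to comparing constant terms. -/
lemma eq_const_mul_of_rank_eq_one {k : ℤ} (hk : Module.rank ℂ (ModularForm 𝒮ℒ k) = 1)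
    {f : ℍ → ℂ} {c : ℂ} (hf : MDiff f)
    (hinv : ∀ γ : SL(2, ℤ), f ∣[k] γ = f) (hlim : Tendsto f atImInfty (𝓝 c))
    {g : ModularForm 𝒮ℒ k} (hg : Tendsto g atImInfty (𝓝 1)) (z : ℍ) : f z = c * g z := by
  have hg0 : g ≠ 0 := by
    rintro rfl
    exact one_ne_zero (tendsto_nhds_unique hg (by simpa using! tendsto_const_nhds))
  obtain ⟨a, ha⟩ := (finrank_eq_one_iff_of_nonzero' g hg0).mp
    (Module.rank_eq_one_iff_finrank_eq_one.mp hk) (modularFormOfTendsto hf hinv hlim)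
  have ha' (z : ℍ) : f z = a * g z := (DFunLike.congr_fun ha z).symm
  have hlim' : Tendsto f atImInfty (𝓝 (a * 1)) := by
    simpa only [← ha'] using hg.const_mul a
  rw [ha', tendsto_nhds_unique hlim hlim', mul_one]

end LambertSeries

/-! ### Ramanujan's differential equations for `E₂`, `E₄`, `E₆` -/

section RamanujanIdentities

open UpperHalfPlane hiding I
open ModularForm EisensteinSeries Derivative
open scoped MatrixGroups Manifold

lemma tendsto_E2_atImInfty : Tendsto E2 atImInfty (𝓝 1) := by
  have h := tendsto_comp_exp_atImInfty
    (continuousAt_zero_of_differentiableOn_ball differentiableOn_ramanujanP)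
  simp only [← E2_eq_ramanujanP] at h
  simpa [ramanujanP_eq, lambertSeries_zero] using h

lemma tendsto_E₄_atImInfty : Tendsto E₄ atImInfty (𝓝 1) := by
  have h := tendsto_comp_exp_atImInfty
    (continuousAt_zero_of_differentiableOn_ball differentiableOn_ramanujanQ)
  simp only [← E₄_eq_ramanujanQ] at h
  simpa [ramanujanQ_eq, lambertSeries_zero] using h

lemma tendsto_E₆_atImInfty : Tendsto E₆ atImInfty (𝓝 1) := by
  have h := tendsto_comp_exp_atImInfty
    (continuousAt_zero_of_differentiableOn_ball differentiableOn_ramanujanR)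
  simp only [← E₆_eq_ramanujanR] at h
  simpa [ramanujanR_eq, lambertSeries_zero] using h

lemma slash_SL_eq {k : ℤ} (f : ModularForm 𝒮ℒ k) (γ : SL(2, ℤ)) : (f : ℍ → ℂ) ∣[k] γ = f :=
  f.slash_action_eq' _ ⟨γ, rfl⟩

/-- Ramanujan's identity for the derivative of `E₄`. -/
lemma normalizedDeriv_E₄ (z : ℍ) : D E₄ z = (E2 z * E₄ z - E₆ z) / 3 := by
  have hm : MDiff (E₄ : ℍ → ℂ) := E₄.holo'
  -- The constant term is that of `-(4/12) E₂ E₄`, as `D E₄` vanishes at `i∞`.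
  have hlim : Tendsto (serreDerivative 4 E₄) atImInfty (𝓝 (-1 / 3)) := by
    have h := (tendsto_normalizedDeriv_atImInfty differentiableOn_ramanujanQ
      E₄_eq_ramanujanQ).sub ((tendsto_E2_atImInfty.const_mul (4 * 12⁻¹)).mul tendsto_E₄_atImInfty)
    refine h.congr' ?_ |>.trans (by norm_num)
    exact .of_forall fun z ↦ by simp [serreDerivative_apply]
  have h := eq_const_mul_of_rank_eq_one levelOne_weight_six_rank_one
    (serreDerivative_mdifferentiable 4 hm)
    (fun γ ↦ serreDerivative_slash_invariant (k := 4) hm (slash_SL_eq E₄ γ)) hlim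
    tendsto_E₆_atImInfty z
  rw [serreDerivative_apply] at h
  linear_combination h

/-- Ramanujan's identity for the derivative of `E₆`. -/
lemma normalizedDeriv_E₆ (z : ℍ) : D E₆ z = (E2 z * E₆ z - E₄ z ^ 2) / 2 := by
  have hm : MDiff (E₆ : ℍ → ℂ) := E₆.holo'
  have hlim : Tendsto (serreDerivative 6 E₆) atImInfty (𝓝 (-1 / 2)) := by
    have h := (tendsto_normalizedDeriv_atImInfty differentiableOn_ramanujanR
      E₆_eq_ramanujanR).sub ((tendsto_E2_atImInfty.const_mul (6 * 12⁻¹)).mul tendsto_E₆_atImInfty)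
    refine h.congr' ?_ |>.trans (by norm_num)
    exact .of_forall fun z ↦ by simp [serreDerivative_apply]
  have hrank : Module.rank ℂ (ModularForm 𝒮ℒ 8) = 1 := by
    simpa [Nat.ModEq] using dimension_level_one 8 ⟨4, rfl⟩
  have hg : Tendsto (E₄.mul E₄ : ModularForm 𝒮ℒ 8) atImInfty (𝓝 1) := by
    simpa using! tendsto_E₄_atImInfty.mul tendsto_E₄_atImInfty
  have h := eq_const_mul_of_rank_eq_one hrank
    (serreDerivative_mdifferentiable 6 hm)
    (fun γ ↦ serreDerivative_slash_invariant (k := 6) hm (slash_SL_eq E₆ γ)) hlim hg z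
  rw [serreDerivative_apply, show (E₄.mul E₄ : ModularForm 𝒮ℒ 8) z = E₄ z * E₄ z from rfl] at h
  linear_combination h

lemma E2_slash_apply (γ : SL(2, ℤ)) (z : ℍ) :
    (E2 ∣[(2 : ℤ)] γ) z = E2 z - 6 * I / Real.pi * (γ 1 0 / denom γ z) := by
  rw [E2_slash_action]
  simp only [Pi.sub_apply, Pi.smul_apply, smul_eq_mul, D2, riemannZeta_two]
  field_simp

/-- The derivative of `c / (cz + d)` is minus its square, so the anomaly of `E₂` differentiates to a
multiple of `(c / (cz + d))²`. The square of the anomaly, which occurs in the transformation of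
`E₂²`, has the same shape. -/
lemma normalizedDeriv_E2_slash (γ : SL(2, ℤ)) (z : ℍ) :
    D (E2 ∣[(2 : ℤ)] γ) z = D E2 z + 3 / Real.pi ^ 2 * (γ 1 0 / denom γ z) ^ 2 := by
  have hd : HasDerivAt (fun w : ℂ ↦ ((γ 1 0 : ℤ) : ℂ) / denom γ w)
      (-(γ 1 0 / denom γ z) ^ 2) z := by
    have h1 : HasDerivAt (fun w : ℂ ↦ denom γ w) (γ 1 0) z := by
      simpa [denom] using ((hasDerivAt_id (z : ℂ)).const_mul
        ((γ 1 0 : ℤ) : ℂ)).add_const ((γ 1 1 : ℤ) : ℂ)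
    have h2 := (hasDerivAt_const (z : ℂ) ((γ 1 0 : ℤ) : ℂ)).div h1 (denom_ne_zero γ z)
    refine h2.congr_deriv ?_
    field_simp
    ring
  have hE : HasDerivAt (E2 ∘ ofComplex) (deriv (E2 ∘ ofComplex) z) z :=
    (mdifferentiableAt_iff.mp (E2_mdifferentiable z)).hasDerivAt
  have he : (E2 ∣[(2 : ℤ)] γ) ∘ ofComplex =ᶠ[𝓝 (z : ℂ)] fun w ↦
      (E2 ∘ ofComplex) w - 6 * I / Real.pi * (γ 1 0 / denom γ w) := by
    filter_upwards [isOpen_upperHalfPlaneSet.mem_nhds z.im_pos] with w hw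
    simp [E2_slash_apply, ofComplex_apply_of_im_pos hw]
  have hs := ((hE.sub (hd.const_mul (6 * I / Real.pi))).congr_of_eventuallyEq he).deriv
  rw [normalizedDerivOfComplex, hs, normalizedDerivOfComplex]
  have : (Real.pi : ℂ) ≠ 0 := by exact_mod_cast Real.pi_ne_zero
  field_simp
  ring

/-- Ramanujan's identity for the derivative of `E₂`. -/
lemma normalizedDeriv_E2 (z : ℍ) : D E2 z = (E2 z ^ 2 - E₄ z) / 12 := by
  -- The coefficient is `1/12` and not the `2/12` of the Serre derivative in weight 2: as `E₂` is
  -- only quasimodular, this is the combination in which all anomalies cancel.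
  set f : ℍ → ℂ := D E2 - (1 / 12 : ℂ) • (E2 * E2) with hf
  have hm : MDiff f :=
    (normalizedDerivOfComplex_mdifferentiable E2_mdifferentiable).sub
      ((E2_mdifferentiable.mul E2_mdifferentiable).const_smul _)
  have hlim : Tendsto f atImInfty (𝓝 (-1 / 12)) := by
    have h := (tendsto_normalizedDeriv_atImInfty differentiableOn_ramanujanP
      E2_eq_ramanujanP).sub ((tendsto_E2_atImInfty.mul tendsto_E2_atImInfty).const_mul (1 / 12))
    refine h.congr' ?_ |>.trans (by norm_num)
    exact .of_forall fun z ↦ by simp [f]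
  have hinv (γ : SL(2, ℤ)) : f ∣[(4 : ℤ)] γ = f := by
    ext z
    have h1 := congrFun (normalizedDerivOfComplex_SL_slash (k := 2) (γ := γ) E2_mdifferentiable) z
    rw [normalizedDeriv_E2_slash] at h1
    simp only [Pi.sub_apply, E2_slash_apply] at h1
    have h2 := congrFun (ModularForm.mul_slash_SL2 2 2 γ E2 E2) z
    simp only [Pi.mul_apply, E2_slash_apply] at h2
    have h3 : (f ∣[(4 : ℤ)] γ) z = (D E2 ∣[(4 : ℤ)] γ) z
        - 1 / 12 * ((E2 * E2) ∣[(4 : ℤ)] γ) z := by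
      simp only [ModularForm.SL_slash_apply, hf, Pi.sub_apply, Pi.smul_apply, smul_eq_mul]
      norm_num
      ring
    rw [show (2 + 2 : ℤ) = 4 by rfl] at h1 h2
    rw [h3, h2]
    have h4 : f z = D E2 z - 1 / 12 * (E2 z * E2 z) := rfl
    rw [h4]
    have hinv : (2 * Real.pi * I : ℂ)⁻¹ = -I / 2 * (Real.pi : ℂ)⁻¹ := by
      simp only [mul_inv, inv_I]
      ring
    push_cast at h1
    rw [hinv] at h1
    simp only [div_eq_mul_inv] at h1 ⊢
    linear_combination -h1 + 3 * (Real.pi : ℂ)⁻¹ ^ 2 * (γ 1 0 * (denom γ z)⁻¹) ^ 2 * I_sq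
  have h := eq_const_mul_of_rank_eq_one levelOne_weight_four_rank_one hm hinv hlim
    tendsto_E₄_atImInfty z
  have h4 : f z = D E2 z - 1 / 12 * (E2 z * E2 z) := rfl
  rw [h4] at h
  linear_combination h

end RamanujanIdentities

/-! ### `P`, `Q`, `R` as functions of `z`, and the modular function `(Q³ - R²)/Q³` -/

section EisensteinFunctions

open UpperHalfPlane hiding I
open ModularForm EisensteinSeries Derivative
open scoped MatrixGroups Manifold

/-- Ramanujan's `P` as a function of `z`, with `q = exp (2πiz)`. -/
noncomputable def eisP (z : ℂ) : ℂ := ramanujanP (exp (2 * Real.pi * I * z))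

/-- Ramanujan's `Q` as a function of `z`, with `q = exp (2πiz)`. -/
noncomputable def eisQ (z : ℂ) : ℂ := ramanujanQ (exp (2 * Real.pi * I * z))

/-- Ramanujan's `R` as a function of `z`, with `q = exp (2πiz)`. -/
noncomputable def eisR (z : ℂ) : ℂ := ramanujanR (exp (2 * Real.pi * I * z))

/-- The function `(Q³ - R²) / Q³` of `q`. -/
noncomputable def nomeTriangle (q : ℂ) : ℂ :=
  (ramanujanQ q ^ 3 - ramanujanR q ^ 2) / ramanujanQ q ^ 3

/-- The function `(Q³ - R²) / Q³` of `z`, with `q = exp (2πiz)`. -/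
noncomputable def eisTriangle (z : ℂ) : ℂ := (eisQ z ^ 3 - eisR z ^ 2) / eisQ z ^ 3

lemma eisTriangle_eq (z : ℂ) : eisTriangle z = nomeTriangle (exp (2 * Real.pi * I * z)) := rfl

lemma hasDerivAt_of_normalizedDeriv {F : ℍ → ℂ} {f : ℂ → ℂ}
    (hF : ∀ z : ℍ, F z = f z) {z : ℂ} (hz : 0 < z.im) (hf : DifferentiableAt ℂ f z) :
    HasDerivAt f (2 * Real.pi * I * D F ⟨z, hz⟩) z := by
  have he : F ∘ ofComplex =ᶠ[𝓝 z] f := by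
    filter_upwards [isOpen_upperHalfPlaneSet.mem_nhds hz] with w hw
    simp [hF, ofComplex_apply_of_im_pos hw]
  rw [normalizedDerivOfComplex, mul_inv_cancel_left₀ two_pi_I_ne_zero]
  rw [show ((⟨z, hz⟩ : ℍ) : ℂ) = z from rfl, he.deriv_eq]
  exact hf.hasDerivAt

lemma hasDerivAt_eisP {z : ℂ} (hz : 0 < z.im) :
    HasDerivAt eisP (2 * Real.pi * I * ((eisP z ^ 2 - eisQ z) / 12)) z := by
  have h := hasDerivAt_of_normalizedDeriv E2_eq_ramanujanP hz
    (hasDerivAt_comp_exp differentiableOn_ramanujanP hz).differentiableAt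
  rwa [normalizedDeriv_E2, E2_eq_ramanujanP, E₄_eq_ramanujanQ] at h

lemma hasDerivAt_eisQ {z : ℂ} (hz : 0 < z.im) :
    HasDerivAt eisQ (2 * Real.pi * I * ((eisP z * eisQ z - eisR z) / 3)) z := by
  have h := hasDerivAt_of_normalizedDeriv E₄_eq_ramanujanQ hz
    (hasDerivAt_comp_exp differentiableOn_ramanujanQ hz).differentiableAt
  rwa [normalizedDeriv_E₄, E2_eq_ramanujanP, E₄_eq_ramanujanQ, E₆_eq_ramanujanR] at h

lemma hasDerivAt_eisR {z : ℂ} (hz : 0 < z.im) :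
    HasDerivAt eisR (2 * Real.pi * I * ((eisP z * eisR z - eisQ z ^ 2) / 2)) z := by
  have h := hasDerivAt_of_normalizedDeriv E₆_eq_ramanujanR hz
    (hasDerivAt_comp_exp differentiableOn_ramanujanR hz).differentiableAt
  rwa [normalizedDeriv_E₆, E2_eq_ramanujanP, E₄_eq_ramanujanQ, E₆_eq_ramanujanR] at h

lemma eisQ_cube_sub_eisR_sq_ne_zero {z : ℂ} (hz : 0 < z.im) : eisQ z ^ 3 - eisR z ^ 2 ≠ 0 := by
  have h1 := discriminant_eq_E₄_cube_sub_E₆_sq ⟨z, hz⟩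
  have h2 := discriminant_ne_zero ⟨z, hz⟩
  rw [E₄_eq_ramanujanQ, E₆_eq_ramanujanR] at h1
  rw [h1] at h2
  exact fun h ↦ h2 (by
    rw [div_eq_zero_iff]
    exact Or.inl h)

lemma modularForm_SL_smul {k : ℤ} (f : ModularForm 𝒮ℒ k) (γ : SL(2, ℤ)) (z : ℍ) :
    f (γ • z) = denom γ z ^ k * f z := by
  have h := congrFun (slash_SL_eq f γ) z
  rw [ModularForm.SL_slash_apply, zpow_neg] at h
  rw [← h]
  field_simp [zpow_ne_zero k (denom_ne_zero γ z)]

lemma eisQ_smul (γ : SL(2, ℤ)) (z : ℍ) : eisQ (γ • z : ℍ) = denom γ z ^ 4 * eisQ z := by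
  have h := modularForm_SL_smul E₄ γ z
  rwa [E₄_eq_ramanujanQ, E₄_eq_ramanujanQ] at h

lemma eisR_smul (γ : SL(2, ℤ)) (z : ℍ) : eisR (γ • z : ℍ) = denom γ z ^ 6 * eisR z := by
  have h := modularForm_SL_smul E₆ γ z
  rwa [E₆_eq_ramanujanR, E₆_eq_ramanujanR] at h

lemma eisTriangle_smul (γ : SL(2, ℤ)) (z : ℍ) :
    eisTriangle (γ • z : ℍ) = eisTriangle z := by
  have hd := denom_ne_zero γ z
  rw [eisTriangle, eisQ_smul, eisR_smul, eisTriangle,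
    show (denom γ z ^ 4 * eisQ z) ^ 3 - (denom γ z ^ 6 * eisR z) ^ 2
      = denom γ z ^ 12 * (eisQ z ^ 3 - eisR z ^ 2) by ring,
    show (denom γ z ^ 4 * eisQ z) ^ 3 = denom γ z ^ 12 * eisQ z ^ 3 by ring,
    mul_div_mul_left _ _ (pow_ne_zero 12 hd)]

/-- `1728 = 3·240 + 2·504`. That it is nonzero makes `q` a holomorphic function of `s` near `s = 0`.
-/
lemma hasDerivAt_nomeTriangle_zero : HasDerivAt nomeTriangle 1728 0 := by
  have hQ : HasDerivAt ramanujanQ 240 0 := by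
    exact (((hasDerivAt_lambertSeries_zero 3).const_mul 240).const_add 1).congr_deriv (by simp)
  have hR : HasDerivAt ramanujanR (-504) 0 := by
    exact (((hasDerivAt_lambertSeries_zero 5).const_mul 504).const_sub 1).congr_deriv (by simp)
  have hQ0 : ramanujanQ 0 = 1 := by simp [ramanujanQ_eq, lambertSeries_zero]
  have hR0 : ramanujanR 0 = 1 := by simp [ramanujanR_eq, lambertSeries_zero]
  have h := ((hQ.pow 3).sub (hR.pow 2)).div (hQ.pow 3) (by simp [hQ0])
  refine h.congr_deriv ?_
  simp [hQ0, hR0]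
  norm_num

lemma nomeTriangle_zero : nomeTriangle 0 = 0 := by
  simp [nomeTriangle, ramanujanQ_eq, ramanujanR_eq, lambertSeries_zero]

lemma tendsto_exp_two_pi_I_mul_I_mul :
    Tendsto (fun t : ℝ ↦ exp (2 * Real.pi * I * (I * t))) atTop (𝓝 0) := by
  rw [tendsto_zero_iff_norm_tendsto_zero]
  have h2 : Tendsto (fun t : ℝ ↦ Real.exp (-(2 * Real.pi * t))) atTop (𝓝 0) :=
    Real.tendsto_exp_neg_atTop_nhds_zero.comp
      (tendsto_id.const_mul_atTop (by positivity))
  refine h2.congr fun t ↦ ?_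
  rw [norm_exp]
  simp

lemma tendsto_eisTriangle_I_mul :
    Tendsto (fun t : ℝ ↦ eisTriangle (I * t)) atTop (𝓝 0) := by
  have h2 := hasDerivAt_nomeTriangle_zero.continuousAt.tendsto.comp tendsto_exp_two_pi_I_mul_I_mul
  rw [nomeTriangle_zero] at h2
  exact h2

/-- The point `i` is fixed by `z ↦ -1/z`, whose weight 6 automorphy factor there is `i⁶ = -1`. -/
lemma eisR_I : eisR I = 0 := by
  have h := eisR_smul ModularGroup.S UpperHalfPlane.I
  rw [modular_S_smul, ModularGroup.denom_S] at h
  have h1 : ((UpperHalfPlane.mk (-UpperHalfPlane.I : ℂ)⁻¹ UpperHalfPlane.I.im_inv_neg_coe_pos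
      : ℍ) : ℂ) = I := by
    simp
  rw [h1] at h
  simp only [coe_I] at h
  have h6 : (I : ℂ) ^ 6 = -1 := by
    rw [show (I : ℂ) ^ 6 = (I ^ 2) ^ 3 by ring, I_sq]
    norm_num
  rw [h6] at h
  linear_combination h / 2

/-- At the fixed point `i` of `z ↦ -1/z` the weight 2 factor is `-1`, so the anomaly of `E₂`
determines its value. -/
lemma eisP_I : eisP I = 3 / Real.pi := by
  have h := E2_slash_apply ModularGroup.S UpperHalfPlane.I
  rw [ModularForm.SL_slash_apply, modular_S_smul, ModularGroup.denom_S] at h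
  have h1 : UpperHalfPlane.mk (-UpperHalfPlane.I : ℂ)⁻¹ UpperHalfPlane.I.im_inv_neg_coe_pos
      = UpperHalfPlane.I := by
    ext
    simp
  rw [h1, E2_eq_ramanujanP] at h
  simp only [coe_I] at h
  change eisP I * _ = eisP I - _ at h
  have hpi : (Real.pi : ℂ) ≠ 0 := by exact_mod_cast Real.pi_ne_zero
  simp [ModularGroup.S, zpow_neg] at h
  field_simp at h ⊢
  linear_combination -h / 2 - 3 * I_sq

end EisensteinFunctions

/-! ### Ramanujan's system on the imaginary axis -/

section ImaginaryAxis

open scoped ArithmeticFunction.sigma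

lemma hasSum_lambertSeries_re (k : ℕ) {x : ℝ} (h0 : 0 ≤ x) (h1 : x < 1) :
    HasSum (fun n : ℕ ↦ (σ k n : ℝ) * x ^ n) (lambertSeries k x).re := by
  have h := Complex.hasSum_re (hasSum_lambertSeries k (q := x) (by simpa [abs_of_nonneg h0]))
  refine h.congr_fun ?_
  intro n
  rw [← ofReal_pow, ← ofReal_natCast, ← ofReal_mul, ofReal_re]

lemma lambertSeries_ofReal (k : ℕ) (x : ℝ) :
    lambertSeries k x = ((lambertSeries k x).re : ℂ) := by
  have h : lambertSeries k x =
      ((∑' n : ℕ+, (n : ℝ) ^ k * x ^ (n : ℕ) / (1 - x ^ (n : ℕ)) : ℝ) : ℂ) := by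
    simp [lambertSeries, ofReal_tsum]
  rw [h, ofReal_re]

lemma lambertSeries_re_strictMono (k : ℕ) {x y : ℝ} (h0 : 0 ≤ x) (hxy : x < y) (h1 : y < 1) :
    (lambertSeries k x).re < (lambertSeries k y).re := by
  refine hasSum_lt (i := 1) (fun n ↦ ?_) (by simpa) (hasSum_lambertSeries_re k h0 (hxy.trans h1))
    (hasSum_lambertSeries_re k (h0.trans hxy.le) h1)
  dsimp only
  gcongr

lemma lambertSeries_re_pos (k : ℕ) {x : ℝ} (h0 : 0 < x) (h1 : x < 1) :
    0 < (lambertSeries k x).re := by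
  simpa [lambertSeries_zero] using lambertSeries_re_strictMono k le_rfl h0 h1

lemma exp_two_pi_I_mul_I_mul (y : ℝ) :
    exp (2 * Real.pi * I * (I * y)) = (Real.exp (-(2 * Real.pi * y)) : ℂ) := by
  rw [show 2 * Real.pi * I * (I * y) = ((-(2 * Real.pi * y) : ℝ) : ℂ) by
    push_cast
    linear_combination 2 * Real.pi * y * I_sq, ofReal_exp]

/-- The value of `P` at `z = iy`. -/
noncomputable def axisP (y : ℝ) : ℝ := (eisP (I * y)).re

/-- The value of `Q` at `z = iy`. -/
noncomputable def axisQ (y : ℝ) : ℝ := (eisQ (I * y)).re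

/-- The value of `R` at `z = iy`. -/
noncomputable def axisR (y : ℝ) : ℝ := (eisR (I * y)).re

lemma eisP_I_mul (y : ℝ) : eisP (I * y) = axisP y := by
  rw [axisP, eisP, exp_two_pi_I_mul_I_mul, ramanujanP_eq, lambertSeries_ofReal]
  simp

lemma eisQ_I_mul (y : ℝ) : eisQ (I * y) = axisQ y := by
  rw [axisQ, eisQ, exp_two_pi_I_mul_I_mul, ramanujanQ_eq, lambertSeries_ofReal]
  simp

lemma eisR_I_mul (y : ℝ) : eisR (I * y) = axisR y := by
  rw [axisR, eisR, exp_two_pi_I_mul_I_mul, ramanujanR_eq, lambertSeries_ofReal]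
  simp

lemma axisQ_eq (y : ℝ) :
    axisQ y = 1 + 240 * (lambertSeries 3 (Real.exp (-(2 * Real.pi * y)) : ℝ)).re := by
  rw [axisQ, eisQ, exp_two_pi_I_mul_I_mul, ramanujanQ_eq, lambertSeries_ofReal]
  simp

lemma axisR_eq (y : ℝ) :
    axisR y = 1 - 504 * (lambertSeries 5 (Real.exp (-(2 * Real.pi * y)) : ℝ)).re := by
  rw [axisR, eisR, exp_two_pi_I_mul_I_mul, ramanujanR_eq, lambertSeries_ofReal]
  simp

lemma exp_neg_two_pi_mul_lt_one {y : ℝ} (hy : 0 < y) : Real.exp (-(2 * Real.pi * y)) < 1 := by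
  have := Real.pi_pos
  rw [Real.exp_lt_one_iff]
  have : 0 < 2 * Real.pi * y := by positivity
  linarith

lemma one_lt_axisQ {y : ℝ} (hy : 0 < y) : 1 < axisQ y := by
  have := lambertSeries_re_pos 3 (Real.exp_pos _) (exp_neg_two_pi_mul_lt_one hy)
  rw [axisQ_eq]
  linarith

lemma axisR_lt_one {y : ℝ} (hy : 0 < y) : axisR y < 1 := by
  have := lambertSeries_re_pos 5 (Real.exp_pos _) (exp_neg_two_pi_mul_lt_one hy)
  rw [axisR_eq]
  linarith

lemma axisR_one : axisR 1 = 0 := by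
  simp [axisR, eisR_I]

lemma axisP_one : axisP 1 = 3 / Real.pi := by
  have h := eisP_I_mul 1
  rw [ofReal_one, mul_one, eisP_I] at h
  exact_mod_cast h.symm

/-- On the axis `R` decreases as the nome `exp (-2πy)` grows, and it reaches `0` at `y = 1`. -/
lemma axisR_pos {y : ℝ} (hy : 1 < y) : 0 < axisR y := by
  have h := lambertSeries_re_strictMono 5 (Real.exp_pos (-(2 * Real.pi * y))).le
    (y := Real.exp (-(2 * Real.pi * 1)))
    (by
      have := Real.pi_pos
      rw [Real.exp_lt_exp]
      nlinarith) (exp_neg_two_pi_mul_lt_one one_pos)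
  have h1 := axisR_eq 1
  rw [axisR_one] at h1
  rw [axisR_eq]
  linarith

/-- The derivative along the imaginary axis of a function that is real there. -/
lemma hasDerivAt_axis {f : ℂ → ℂ} {f' : ℝ} {y : ℝ}
    (h : HasDerivAt f (2 * Real.pi * I * f') (I * y)) :
    HasDerivAt (fun y : ℝ ↦ (f (I * y)).re) (-(2 * Real.pi * f')) y := by
  have h1 : HasDerivAt (fun y : ℝ ↦ I * (y : ℂ)) I y := by
    simpa using (hasDerivAt_id y).ofReal_comp.const_mul I
  have h2 : HasDerivAt (fun y : ℝ ↦ f (I * (y : ℂ))) (2 * Real.pi * I * f' * I) y :=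
    HasDerivAt.comp y h h1
  have h3 := (reCLM.hasFDerivAt (x := f (I * y))).comp_hasDerivAt y h2
  refine h3.congr_deriv ?_
  rw [show 2 * Real.pi * I * f' * I = ((-(2 * Real.pi * f') : ℝ) : ℂ) by
    push_cast
    linear_combination 2 * Real.pi * f' * I_sq]
  simp

lemma hasDerivAt_axisP {y : ℝ} (hy : 0 < y) :
    HasDerivAt axisP (-(2 * Real.pi * ((axisP y ^ 2 - axisQ y) / 12))) y := by
  refine hasDerivAt_axis ?_
  push_cast
  rw [← eisP_I_mul, ← eisQ_I_mul]
  exact hasDerivAt_eisP (by simpa)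

lemma hasDerivAt_axisQ {y : ℝ} (hy : 0 < y) :
    HasDerivAt axisQ (-(2 * Real.pi * ((axisP y * axisQ y - axisR y) / 3))) y := by
  refine hasDerivAt_axis ?_
  push_cast
  rw [← eisP_I_mul, ← eisQ_I_mul, ← eisR_I_mul]
  exact hasDerivAt_eisQ (by simpa)

lemma hasDerivAt_axisR {y : ℝ} (hy : 0 < y) :
    HasDerivAt axisR (-(2 * Real.pi * ((axisP y * axisR y - axisQ y ^ 2) / 2))) y := by
  refine hasDerivAt_axis ?_
  push_cast
  rw [← eisP_I_mul, ← eisQ_I_mul, ← eisR_I_mul]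
  exact hasDerivAt_eisR (by simpa)

/-- The positive fourth root of `Q` at `z = iy`. -/
noncomputable def axisU (y : ℝ) : ℝ := axisQ y ^ (1 / 4 : ℝ)

/-- The quotient `R / Q^{3/2}` at `z = iy`. -/
noncomputable def axisW (y : ℝ) : ℝ := axisR y / axisU y ^ 6

/-- The value of `(Q³ - R²) / Q³` at `z = iy`. -/
noncomputable def axisS (y : ℝ) : ℝ := 1 - axisW y ^ 2

lemma axisU_pos {y : ℝ} (hy : 0 < y) : 0 < axisU y :=
  Real.rpow_pos_of_pos (one_pos.trans (one_lt_axisQ hy)) _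

lemma one_lt_axisU {y : ℝ} (hy : 0 < y) : 1 < axisU y :=
  Real.one_lt_rpow (one_lt_axisQ hy) (by norm_num)

lemma axisU_pow_four {y : ℝ} (hy : 0 < y) : axisU y ^ 4 = axisQ y := by
  rw [axisU, ← Real.rpow_natCast, ← Real.rpow_mul (one_pos.trans (one_lt_axisQ hy)).le]
  norm_num

lemma axisR_eq_mul {y : ℝ} (hy : 0 < y) : axisR y = axisW y * axisU y ^ 6 := by
  rw [axisW, div_mul_cancel₀ _ (pow_ne_zero 6 (axisU_pos hy).ne')]

lemma hasDerivAt_axisU {y : ℝ} (hy : 0 < y) :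
    HasDerivAt axisU (-(Real.pi / 6 * (axisP y * axisU y - axisW y * axisU y ^ 3))) y := by
  have h := (hasDerivAt_axisQ hy).rpow_const (p := 1 / 4)
    (Or.inl (one_pos.trans (one_lt_axisQ hy)).ne')
  refine h.congr_deriv ?_
  have hU := axisU_pos hy
  have h3 : axisQ y ^ (1 / 4 - 1 : ℝ) = axisU y / axisU y ^ 4 := by
    rw [Real.rpow_sub_one (one_pos.trans (one_lt_axisQ hy)).ne', axisU_pow_four hy, axisU]
  rw [h3, axisR_eq_mul hy, ← axisU_pow_four hy]
  field_simp
  ring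

/-- `R / Q^{3/2}` has weight 0, so the terms with `P` cancel. -/
lemma hasDerivAt_axisW {y : ℝ} (hy : 0 < y) :
    HasDerivAt axisW (Real.pi * axisS y * axisU y ^ 2) y := by
  have hU := axisU_pos hy
  have h := (hasDerivAt_axisR hy).div ((hasDerivAt_axisU hy).pow 6) (pow_ne_zero 6 hU.ne')
  refine h.congr_deriv ?_
  rw [axisR_eq_mul hy, ← axisU_pow_four hy, axisS]
  simp only [Pi.pow_apply]
  field_simp
  push_cast
  ring

lemma hasDerivAt_axisS {y : ℝ} (hy : 0 < y) :
    HasDerivAt axisS (-(2 * Real.pi * axisW y * axisS y * axisU y ^ 2)) y := by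
  refine (((hasDerivAt_axisW hy).pow 2).const_sub 1).congr_deriv ?_
  ring

lemma axisW_pos {y : ℝ} (hy : 1 < y) : 0 < axisW y :=
  div_pos (axisR_pos hy) (pow_pos (axisU_pos (one_pos.trans hy)) 6)

lemma axisW_lt_one {y : ℝ} (hy : 1 < y) : axisW y < 1 := by
  have hy' := one_pos.trans hy
  rw [axisW, div_lt_one (pow_pos (axisU_pos hy') 6)]
  exact (axisR_lt_one hy').trans (one_lt_pow₀ (one_lt_axisU hy') (by norm_num))

lemma axisW_one : axisW 1 = 0 := by simp [axisW, axisR_one]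

lemma axisS_pos {y : ℝ} (hy : 1 < y) : 0 < axisS y := by
  have := axisW_pos hy
  have := axisW_lt_one hy
  rw [axisS]
  nlinarith

lemma axisS_lt_one {y : ℝ} (hy : 1 < y) : axisS y < 1 := by
  have := axisW_pos hy
  rw [axisS]
  nlinarith

lemma axisS_one : axisS 1 = 1 := by simp [axisS, axisW_one]

lemma eisTriangle_I_mul {y : ℝ} (hy : 0 < y) : eisTriangle (I * y) = axisS y := by
  have hU : (axisU y : ℂ) ≠ 0 := by exact_mod_cast (axisU_pos hy).ne'
  rw [eisTriangle, eisQ_I_mul, eisR_I_mul, axisR_eq_mul hy, ← axisU_pow_four hy, axisS]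
  push_cast
  field_simp

lemma tendsto_axisS_atTop : Tendsto axisS atTop (𝓝 0) := by
  have h := (continuous_re.tendsto _).comp tendsto_eisTriangle_I_mul
  rw [zero_re] at h
  refine h.congr' ?_
  filter_upwards [eventually_gt_atTop 0] with y hy
  simp [eisTriangle_I_mul hy]

lemma tendsto_axisU_atTop : Tendsto axisU atTop (𝓝 1) := by
  have h : Tendsto (fun y : ℝ ↦ (Real.exp (-(2 * Real.pi * y)) : ℂ)) atTop (𝓝 0) := by
    have h2 : Tendsto (fun t : ℝ ↦ Real.exp (-(2 * Real.pi * t))) atTop (𝓝 0) :=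
      Real.tendsto_exp_neg_atTop_nhds_zero.comp
        (tendsto_id.const_mul_atTop (by positivity))
    exact_mod_cast (continuous_ofReal.tendsto 0).comp h2
  have hQ : Tendsto axisQ atTop (𝓝 1) := by
    have hc := (continuousAt_zero_of_differentiableOn_ball differentiableOn_ramanujanQ).tendsto.comp
      h
    have h3 := (continuous_re.tendsto _).comp hc
    simp only [ramanujanQ_eq 0, lambertSeries_zero] at h3
    simp only [mul_zero, add_zero, one_re] at h3
    refine h3.congr fun y ↦ ?_
    rw [axisQ, eisQ, exp_two_pi_I_mul_I_mul]
    rfl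
  have h4 := hQ.rpow_const (p := 1 / 4) (by simp)
  rwa [Real.one_rpow] at h4

end ImaginaryAxis

/-! ### Euler's integral: existence of the principal branches, Gauss's theorem -/

section EulerIntegral

open MeasureTheory intervalIntegral
open scoped Interval

/-- The integrand of the beta integral. -/
noncomputable def betaWeight (b d : ℂ) (t : ℝ) : ℂ := (t : ℂ) ^ (b - 1) * (1 - (t : ℂ)) ^ (d - 1)

/-- Euler's integral `∫₀¹ t^{b-1} (1-t)^{c-b-1} (1-st)^{-a} dt`. -/
noncomputable def eulerIntegral (a b c s : ℂ) : ℂ :=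
  ∫ t in (0 : ℝ)..1, betaWeight b (c - b) t * (1 - s * t) ^ (-a)

lemma intervalIntegrable_betaWeight {b d : ℂ} (hb : 0 < b.re) (hd : 0 < d.re) :
    IntervalIntegrable (betaWeight b d) volume 0 1 :=
  betaIntegral_convergent hb hd

lemma one_sub_mul_mem_slitPlane {s : ℂ} (hs : 1 - s ∈ slitPlane) {t : ℝ} (h0 : 0 ≤ t)
    (h1 : t ≤ 1) : 1 - s * t ∈ slitPlane := by
  have h := starConvex_one_slitPlane.add_smul_sub_mem hs h0 h1
  convert h using 1
  simp
  ring

lemma hasDerivAt_eulerKernel (a : ℂ) {s : ℂ} (hs : 1 - s ∈ slitPlane) {t : ℝ} (h0 : 0 ≤ t)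
    (h1 : t ≤ 1) :
    HasDerivAt (fun s : ℂ ↦ (1 - s * t) ^ (-a)) (a * t * (1 - s * t) ^ (-a - 1)) s := by
  have h : HasDerivAt (fun s : ℂ ↦ 1 - s * t) (-t) s := by
    simpa using ((hasDerivAt_id s).mul_const (t : ℂ)).const_sub 1
  refine (h.cpow_const (one_sub_mul_mem_slitPlane hs h0 h1)).congr_deriv ?_
  ring

lemma continuousOn_eulerKernel (a : ℂ) {K : Set ℂ} (hK : ∀ s ∈ K, 1 - s ∈ slitPlane) :
    ContinuousOn (fun p : ℂ × ℝ ↦ (1 - p.1 * p.2) ^ a) (K ×ˢ Set.Icc 0 1) := by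
  refine ContinuousOn.cpow_const (by fun_prop) fun p hp ↦ ?_
  exact one_sub_mul_mem_slitPlane (hK _ hp.1) hp.2.1 hp.2.2

lemma continuousOn_eulerKernel_right (a : ℂ) {s : ℂ} (hs : 1 - s ∈ slitPlane) :
    ContinuousOn (fun t : ℝ ↦ (1 - s * t) ^ a) [[0, 1]] := by
  rw [Set.uIcc_of_le zero_le_one]
  refine ContinuousOn.cpow_const (by fun_prop) fun t ht ↦ ?_
  exact one_sub_mul_mem_slitPlane hs ht.1 ht.2

lemma isOpen_one_sub_mem_slitPlane : IsOpen {s : ℂ | 1 - s ∈ slitPlane} :=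
  isOpen_slitPlane.preimage (by fun_prop : Continuous fun s : ℂ ↦ 1 - s)

lemma differentiableOn_eulerIntegral (a : ℂ) {b c : ℂ} (hb : 0 < b.re) (hbc : b.re < c.re) :
    DifferentiableOn ℂ (eulerIntegral a b c) {s | 1 - s ∈ slitPlane} := by
  intro s hs
  have hw := intervalIntegrable_betaWeight hb (d := c - b) (by simpa using hbc)
  obtain ⟨ε, hε, hball⟩ := Metric.nhds_basis_closedBall.mem_iff.mp
    (isOpen_one_sub_mem_slitPlane.mem_nhds hs)
  obtain ⟨M, hM⟩ := ((isCompact_closedBall s ε).prod isCompact_Icc).exists_bound_of_continuousOn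
    (continuousOn_eulerKernel (-a - 1) hball)
  have hint (e : ℂ) {s : ℂ} (hs : 1 - s ∈ slitPlane) :
      IntervalIntegrable (fun t : ℝ ↦ betaWeight b (c - b) t * (1 - s * t) ^ e) volume 0 1 :=
    hw.mul_continuousOn (continuousOn_eulerKernel_right e hs)
  refine (hasDerivAt_integral_of_dominated_loc_of_deriv_le
    (F := fun s t ↦ betaWeight b (c - b) t * (1 - s * t) ^ (-a))
    (F' := fun s t ↦ betaWeight b (c - b) t * (a * t * (1 - s * t) ^ (-a - 1)))
    (bound := fun t ↦ ‖betaWeight b (c - b) t‖ * (‖a‖ * M))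
    (Metric.closedBall_mem_nhds s hε) ?_ (hint _ hs) ?_ ?_ ?_ ?_).2.differentiableAt
      |>.differentiableWithinAt
  · filter_upwards [Metric.closedBall_mem_nhds s hε] with x hx
    have := (hint (-a) (hball hx)).aestronglyMeasurable
    rwa [Set.uIoc_of_le zero_le_one]
  · have : IntervalIntegrable
        (fun t : ℝ ↦ betaWeight b (c - b) t * (a * t * (1 - s * t) ^ (-a - 1))) volume 0 1 :=
      hw.mul_continuousOn (ContinuousOn.mul (by fun_prop) (continuousOn_eulerKernel_right _ hs))
    have := this.aestronglyMeasurable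
    rwa [Set.uIoc_of_le zero_le_one]
  · refine .of_forall fun t ht x hx ↦ ?_
    rw [Set.uIoc_of_le zero_le_one] at ht
    rw [norm_mul]
    refine mul_le_mul_of_nonneg_left ?_ (norm_nonneg _)
    rw [norm_mul, norm_mul, mul_assoc]
    refine mul_le_mul_of_nonneg_left ?_ (norm_nonneg _)
    have h1 : ‖(t : ℂ)‖ ≤ 1 := by simpa [abs_of_pos ht.1] using ht.2
    have h2 := hM (x, t) ⟨hx, ht.1.le, ht.2⟩
    calc _ ≤ 1 * ‖(1 - x * t) ^ (-a - 1)‖ := mul_le_mul_of_nonneg_right h1 (norm_nonneg _)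
      _ ≤ M := by simpa using h2
  · exact hw.norm.mul_const _
  · refine .of_forall fun t ht x hx ↦ ?_
    rw [Set.uIoc_of_le zero_le_one] at ht
    exact (hasDerivAt_eulerKernel a (hball hx) ht.1.le ht.2).const_mul _

lemma choose_eq_ascPochhammer_eval (a : ℂ) (n : ℕ) :
    Ring.choose (a + n - 1) n = (n.factorial : ℂ)⁻¹ * (ascPochhammer ℂ n).eval a := by
  rw [Ring.choose_eq_smul, Polynomial.descPochhammer_smeval_eq_ascPochhammer,
    Polynomial.ascPochhammer_smeval_cast, Polynomial.ascPochhammer_smeval_eq_eval,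
    show a + n - 1 - n + 1 = a by ring]
  simp

lemma hasSum_one_sub_cpow_neg (a : ℂ) {x : ℂ} (hx : ‖x‖ < 1) :
    HasSum (fun n : ℕ ↦ (n.factorial : ℂ)⁻¹ * (ascPochhammer ℂ n).eval a * x ^ n)
      ((1 - x) ^ (-a)) := by
  have h := (one_div_one_sub_cpow_hasFPowerSeriesOnBall_zero a).hasSum (y := x) (by
    rwa [← ENNReal.coe_one, Metric.eball_coe, NNReal.coe_one, mem_ball_zero_iff])
  simpa [FormalMultilinearSeries.ofScalars_apply_eq, choose_eq_ascPochhammer_eval, cpow_neg,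
    mul_comm, mul_left_comm, mul_assoc] using h

lemma betaIntegral_add_one_left {u v : ℂ} (hu : 0 < u.re) (hv : 0 < v.re) :
    betaIntegral (u + 1) v = u / (u + v) * betaIntegral u v := by
  have huv : u + v ≠ 0 := fun h ↦ by
    have := congrArg re h
    simp at this
    linarith
  have hu0 : u ≠ 0 := fun h ↦ by simp [h] at hu
  have h1 := Gamma_mul_Gamma_eq_betaIntegral hu hv
  have h2 := Gamma_mul_Gamma_eq_betaIntegral (s := u + 1) (by simp; linarith) hv
  rw [Gamma_add_one u hu0, add_right_comm, Gamma_add_one _ huv, mul_assoc, h1] at h2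
  have h3 : Gamma (u + v) ≠ 0 := Gamma_ne_zero_of_re_pos (by simp; linarith)
  field_simp
  refine mul_left_cancel₀ h3 ?_
  linear_combination -h2

lemma betaIntegral_add_nat_left {u v : ℂ} (hu : 0 < u.re) (hv : 0 < v.re) (n : ℕ) :
    betaIntegral (u + n) v =
      (ascPochhammer ℂ n).eval u * ((ascPochhammer ℂ n).eval (u + v))⁻¹ * betaIntegral u v := by
  induction n with
  | zero => simp
  | succ n ih =>
    have hn : (0 : ℝ) ≤ n := n.cast_nonneg
    rw [Nat.cast_succ, ← add_assoc, betaIntegral_add_one_left (by simp; linarith) hv, ih,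
      ascPochhammer_succ_eval, ascPochhammer_succ_eval, mul_inv]
    rw [show u + n + v = u + v + n by ring]
    ring

lemma integral_betaWeight_mul_pow {b d : ℂ} (n : ℕ) :
    ∫ t in (0 : ℝ)..1, betaWeight b d t * (t : ℂ) ^ n = betaIntegral (b + n) d := by
  rw [betaIntegral]
  refine integral_congr_ae (.of_forall fun t ht ↦ ?_)
  rw [Set.uIoc_of_le zero_le_one] at ht
  have ht0 : (t : ℂ) ≠ 0 := by exact_mod_cast ht.1.ne'
  rw [betaWeight, show b + n - 1 = b - 1 + n by ring, cpow_add _ _ ht0, cpow_natCast]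
  ring

/-- Expand the kernel by the binomial series and integrate termwise; the moments `B(b + n, c - b)`
are `B(b, c - b)` times `(b)ₙ / (c)ₙ`. -/
lemma eulerIntegral_eq_of_norm_lt_one (a : ℂ) {b c : ℂ} (hb : 0 < b.re) (hbc : b.re < c.re)
    {s : ℂ} (hs : ‖s‖ < 1) :
    eulerIntegral a b c s = betaIntegral b (c - b) * ₂F₁ a b c s := by
  have hd : 0 < (c - b).re := by simpa using hbc
  have hw := intervalIntegrable_betaWeight hb hd
  set C : ℕ → ℂ := fun n ↦ (n.factorial : ℂ)⁻¹ * (ascPochhammer ℂ n).eval a with hC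
  have hsum : HasSum (fun n ↦ ∫ t in (0 : ℝ)..1, betaWeight b (c - b) t * (C n * (s * t) ^ n))
      (eulerIntegral a b c s) := by
    have hsn : Summable fun n ↦ ‖C n * s ^ n‖ :=
      (hasSum_one_sub_cpow_neg a hs).summable.norm
    refine hasSum_integral_of_dominated_convergence
      (fun n t ↦ ‖betaWeight b (c - b) t‖ * ‖C n * s ^ n‖) ?_ ?_ ?_ ?_ ?_
    · intro n
      have : IntervalIntegrable (fun t : ℝ ↦ betaWeight b (c - b) t * (C n * (s * t) ^ n))
          volume 0 1 := hw.mul_continuousOn (by fun_prop)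
      have := this.aestronglyMeasurable
      rwa [Set.uIoc_of_le zero_le_one]
    · refine fun n ↦ .of_forall fun t ht ↦ ?_
      rw [Set.uIoc_of_le zero_le_one] at ht
      have h1 : ‖(t : ℂ)‖ ^ n ≤ 1 :=
        pow_le_one₀ (norm_nonneg _) (by simpa [abs_of_pos ht.1] using ht.2)
      rw [norm_mul]
      refine mul_le_mul_of_nonneg_left ?_ (norm_nonneg _)
      rw [mul_pow, ← mul_assoc, norm_mul, norm_pow (t : ℂ)]
      exact mul_le_of_le_one_right (norm_nonneg _) h1
    · exact .of_forall fun t _ ↦ hsn.mul_left _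
    · simp_rw [tsum_mul_left]
      exact hw.norm.mul_const _
    · refine .of_forall fun t ht ↦ ?_
      rw [Set.uIoc_of_le zero_le_one] at ht
      refine (hasSum_one_sub_cpow_neg a ?_).mul_left _
      have h1 : ‖(t : ℂ)‖ ≤ 1 := by simpa [abs_of_pos ht.1] using ht.2
      rw [norm_mul]
      exact (mul_le_of_le_one_right (norm_nonneg _) h1).trans_lt hs
  rw [← hsum.tsum_eq, ordinaryHypergeometric_eq_tsum, ← tsum_mul_left]
  refine tsum_congr fun n ↦ ?_
  have h1 : ∫ t in (0 : ℝ)..1, betaWeight b (c - b) t * (C n * (s * t) ^ n) =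
      C n * s ^ n * ∫ t in (0 : ℝ)..1, betaWeight b (c - b) t * (t : ℂ) ^ n := by
    rw [← intervalIntegral.integral_const_mul]
    congr 1
    ext t
    ring
  rw [h1, integral_betaWeight_mul_pow, betaIntegral_add_nat_left hb hd, hC]
  simp only [add_sub_cancel, smul_eq_mul]
  ring

lemma betaIntegral_ne_zero {u v : ℂ} (hu : 0 < u.re) (hv : 0 < v.re) : betaIntegral u v ≠ 0 := by
  intro h
  have := Gamma_mul_Gamma_eq_betaIntegral hu hv
  rw [h, mul_zero] at this
  exact mul_ne_zero (Gamma_ne_zero_of_re_pos hu) (Gamma_ne_zero_of_re_pos hv) this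

lemma isHypergeometricBranch_eulerIntegral (a : ℂ) {b c : ℂ} (hb : 0 < b.re)
    (hbc : b.re < c.re) :
    IsHypergeometricBranch a b c fun s ↦ (betaIntegral b (c - b))⁻¹ * eulerIntegral a b c s where
  differentiableOn := (differentiableOn_eulerIntegral a hb hbc).const_mul _
  eq_series s hs := by
    rw [eulerIntegral_eq_of_norm_lt_one a hb hbc hs, inv_mul_cancel_left₀]
    exact betaIntegral_ne_zero hb (by simpa using hbc)

lemma isHypergeometricBranch_hypergeometricBranch (a : ℂ) {b c : ℂ} (hb : 0 < b.re)
    (hbc : b.re < c.re) : IsHypergeometricBranch a b c (hypergeometricBranch a b c) := by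
  have h : ∃ f, IsHypergeometricBranch a b c f :=
    ⟨_, isHypergeometricBranch_eulerIntegral a hb hbc⟩
  rw [hypergeometricBranch, dif_pos h]
  exact h.choose_spec

/-- Gauss's summation theorem, as a limit from the left. -/
lemma tendsto_ordinaryHypergeometric_one {a b c : ℝ} (ha : 0 ≤ a) (hb : 0 < b)
    (habc : a + b < c) :
    Tendsto (fun x : ℝ ↦ ₂F₁ (a : ℂ) b c (x : ℂ)) (𝓝[<] 1)
      (𝓝 (Gamma c * Gamma (c - a - b) / (Gamma (c - a) * Gamma (c - b)))) := by
  have hd : 0 < ((c : ℂ) - b).re := by simp; linarith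
  have he : 0 < ((c : ℂ) - b - a).re := by simp; linarith
  have hb' : 0 < (b : ℂ).re := by simpa
  have hw := intervalIntegrable_betaWeight hb' hd
  have hprod {t : ℝ} (ht : t ∈ Set.Ioo (0 : ℝ) 1) :
      betaWeight b (c - b) t * (1 - (t : ℂ)) ^ (-(a : ℂ)) = betaWeight b (c - b - a) t := by
    have h1 : (1 - (t : ℂ)) ≠ 0 := by
      have := (sub_pos.mpr ht.2).ne'
      exact_mod_cast this
    rw [betaWeight, betaWeight, mul_assoc, ← cpow_add _ _ h1]
    ring_nf
  have hne : ∀ᵐ t : ℝ, t ≠ 1 := by simp [ae_iff]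
  have hlim : Tendsto (fun x : ℝ ↦ eulerIntegral a b c x) (𝓝[<] 1)
      (𝓝 (betaIntegral b (c - b - a))) := by
    refine tendsto_integral_filter_of_dominated_convergence
      (fun t ↦ ‖betaWeight b (c - b - a) t‖) ?_ ?_ (intervalIntegrable_betaWeight hb' he).norm ?_
    · filter_upwards [self_mem_nhdsWithin] with x hx
      have h1 : 1 - (x : ℂ) ∈ slitPlane := by
        rw [← ofReal_one, ← ofReal_sub, ofReal_mem_slitPlane]
        exact sub_pos.mpr hx
      have := (hw.mul_continuousOn
        (continuousOn_eulerKernel_right (-(a : ℂ)) h1)).aestronglyMeasurable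
      rwa [Set.uIoc_of_le zero_le_one]
    · filter_upwards [Ioo_mem_nhdsLT (zero_lt_one' ℝ)] with x hx
      filter_upwards [hne] with t ht1 ht
      rw [Set.uIoc_of_le zero_le_one] at ht
      have ht' : t ∈ Set.Ioo (0 : ℝ) 1 := ⟨ht.1, lt_of_le_of_ne ht.2 ht1⟩
      rw [← hprod ht', norm_mul, norm_mul]
      refine mul_le_mul_of_nonneg_left ?_ (norm_nonneg _)
      have h1 : 0 < 1 - t := sub_pos.mpr ht'.2
      -- Since the exponent `-a` is not positive, the kernel for `0 < x < 1` is dominated by its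
      -- limit at `x = 1`. That limit is integrable against the weight because `a + b < c`.
      have h2 : 1 - t ≤ 1 - x * t := by nlinarith [hx.2, ht'.1]
      rw [show 1 - (x : ℂ) * t = ((1 - x * t : ℝ) : ℂ) by push_cast; ring,
        show 1 - (t : ℂ) = ((1 - t : ℝ) : ℂ) by push_cast; ring, ← ofReal_neg,
        norm_cpow_eq_rpow_re_of_pos (h1.trans_le h2), norm_cpow_eq_rpow_re_of_pos h1]
      exact Real.rpow_le_rpow_of_nonpos h1 h2 (by simpa)
    · filter_upwards [hne] with t ht1 ht
      rw [Set.uIoc_of_le zero_le_one] at ht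
      have ht' : t ∈ Set.Ioo (0 : ℝ) 1 := ⟨ht.1, lt_of_le_of_ne ht.2 ht1⟩
      change Tendsto _ _ (𝓝 (betaWeight b (c - b - a) t))
      rw [← hprod ht']
      refine Tendsto.const_mul _ ?_
      have hc : ContinuousAt (fun x : ℝ ↦ (1 - (x : ℂ) * t) ^ (-(a : ℂ))) 1 := by
        refine ContinuousAt.cpow (by fun_prop) continuousAt_const ?_
        rw [ofReal_one, one_mul, ← ofReal_one, ← ofReal_sub, ofReal_mem_slitPlane]
        exact sub_pos.mpr ht'.2
      have := hc.tendsto.mono_left (nhdsWithin_le_nhds (s := Set.Iio 1))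
      simpa using this
  have hval : (betaIntegral b (c - b))⁻¹ * betaIntegral b (c - b - a) =
      Gamma c * Gamma (c - a - b) / (Gamma (c - a) * Gamma (c - b)) := by
    have h1 := Gamma_mul_Gamma_eq_betaIntegral hb' hd
    have h2 := Gamma_mul_Gamma_eq_betaIntegral hb' he
    rw [add_sub_cancel] at h1
    rw [show (b : ℂ) + (c - b - a) = c - a by ring, show (c : ℂ) - b - a = c - a - b by ring] at h2
    rw [show (c : ℂ) - b - a = c - a - b by ring]
    have g1 : Gamma (b : ℂ) ≠ 0 := Gamma_ne_zero_of_re_pos hb'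
    have g2 : Gamma ((c : ℂ) - a) ≠ 0 := Gamma_ne_zero_of_re_pos (by simp; linarith)
    have g3 : Gamma ((c : ℂ) - b) ≠ 0 := Gamma_ne_zero_of_re_pos hd
    have g4 := betaIntegral_ne_zero hb' hd
    field_simp
    refine mul_left_cancel₀ g1 ?_
    linear_combination betaIntegral b (c - a - b) * Gamma (c - a) * h1 -
      betaIntegral b (c - b) * Gamma c * h2
  rw [← hval]
  refine (hlim.const_mul _).congr' ?_
  filter_upwards [Ioo_mem_nhdsLT (zero_lt_one' ℝ)] with x hx
  rw [eulerIntegral_eq_of_norm_lt_one _ hb' (by simp; linarith)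
    (by simpa [abs_of_pos hx.1] using hx.2), inv_mul_cancel_left₀ (betaIntegral_ne_zero hb' hd)]

end EulerIntegral

/-! ### The hypergeometric differential equation for the principal branches -/

section HypergeometricEquation

/-- Multiplication by `s` shifts the coefficients, and `g 0 = 0` supplies the missing constant term.
This writes `s f'`, `s f''` and `s² f''` in powers `sⁿ` that can be compared coefficientwise. -/
lemma HasSum.mul_shift {g : ℕ → ℂ} {s F : ℂ} (hg : g 0 = 0)
    (h : HasSum (fun n ↦ g (n + 1) * s ^ n) F) : HasSum (fun n ↦ g n * s ^ n) (s * F) := by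
  rw [← hasSum_nat_add_iff' 1]
  simp only [Finset.range_one, Finset.sum_singleton, hg, zero_mul, sub_zero]
  refine (h.mul_left s).congr_fun fun n ↦ ?_
  ring

/-- The hypergeometric equation for a power series with the hypergeometric recursion. -/
lemma hypergeometric_ode_of_recursion {a b c : ℂ} {f : ℂ → ℂ}
    (hf : DifferentiableOn ℂ f (Metric.ball 0 1))
    (hrec : ∀ n : ℕ, (n + c) * iteratedDeriv (n + 1) f 0 =
      (n + a) * (n + b) * iteratedDeriv n f 0)
    {s : ℂ} (hs : ‖s‖ < 1) :
    s * (1 - s) * deriv (deriv f) s + (c - (a + b + 1) * s) * deriv f s - a * b * f s = 0 := by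
  have hs' : s ∈ Metric.ball (0 : ℂ) 1 := by simpa using hs
  have hf1 := hf.deriv Metric.isOpen_ball
  have hf2 := hf1.deriv Metric.isOpen_ball
  set d : ℕ → ℂ := fun n ↦ (n.factorial : ℂ)⁻¹ * iteratedDeriv n f 0 with hd
  have hfac (n : ℕ) : (n.factorial : ℂ) ≠ 0 := by exact_mod_cast n.factorial_ne_zero
  have hn (n : ℕ) : (n : ℂ) + 1 ≠ 0 := by exact_mod_cast n.succ_ne_zero
  have hd1 (n : ℕ) : (n.factorial : ℂ)⁻¹ * iteratedDeriv (n + 1) f 0 = (n + 1) * d (n + 1) := by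
    have := hfac n
    have := hn n
    simp only [hd, Nat.factorial_succ]
    push_cast
    field_simp
  have hd2 (n : ℕ) : (n.factorial : ℂ)⁻¹ * iteratedDeriv (n + 2) f 0 =
      (n + 1) * (n + 2) * d (n + 2) := by
    have h1 := hfac n
    have h2 := hn n
    have h3 := hn (n + 1)
    simp only [hd, Nat.factorial_succ]
    push_cast at h3 ⊢
    rw [show (n : ℂ) + 1 + 1 = n + 2 by ring] at *
    field_simp
  have s0 : HasSum (fun n ↦ d n * s ^ n) (f s) := by
    refine (hasSum_taylorSeries_on_ball hf hs').congr_fun fun n ↦ ?_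
    simp [hd]
    ring
  have s1 : HasSum (fun n : ℕ ↦ (n + 1) * d (n + 1) * s ^ n) (deriv f s) := by
    refine (hasSum_taylorSeries_on_ball hf1 hs').congr_fun fun n ↦ ?_
    rw [← hd1, iteratedDeriv_succ']
    simp
    ring
  have s2 : HasSum (fun n : ℕ ↦ (n + 1) * (n + 2) * d (n + 2) * s ^ n) (deriv (deriv f) s) := by
    refine (hasSum_taylorSeries_on_ball hf2 hs').congr_fun fun n ↦ ?_
    rw [← hd2, iteratedDeriv_succ', iteratedDeriv_succ']
    simp
    ring
  have t1 : HasSum (fun n : ℕ ↦ n * d n * s ^ n) (s * deriv f s) :=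
    HasSum.mul_shift (g := fun n ↦ n * d n) (by simp) (s1.congr_fun fun n ↦ by push_cast; ring)
  have t2 : HasSum (fun n : ℕ ↦ n * (n + 1) * d (n + 1) * s ^ n) (s * deriv (deriv f) s) :=
    HasSum.mul_shift (g := fun n ↦ n * (n + 1) * d (n + 1)) (by simp)
      (s2.congr_fun fun n ↦ by push_cast; ring)
  have t3 : HasSum (fun n : ℕ ↦ (n - 1) * n * d n * s ^ n) (s * (s * deriv (deriv f) s)) :=
    HasSum.mul_shift (g := fun n ↦ (n - 1) * n * d n) (by simp)
      (t2.congr_fun fun n ↦ by push_cast; ring)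
  have hsum := (((t2.sub t3).add (s1.mul_left c)).sub (t1.mul_left (a + b + 1))).sub
    (s0.mul_left (a * b))
  have hzero : HasSum (fun _ : ℕ ↦ (0 : ℂ)) _ := hsum.congr_fun fun n ↦ by
    have h1 : (n + c) * ((n + 1) * d (n + 1)) = (n + a) * (n + b) * d n := by
      rw [← hd1]
      simp only [hd]
      linear_combination (n.factorial : ℂ)⁻¹ * hrec n
    linear_combination -s ^ n * h1
  have := hzero.unique hasSum_zero
  linear_combination this

lemma ball_subset_one_sub_mem_slitPlane :
    Metric.ball (0 : ℂ) 1 ⊆ {s | 1 - s ∈ slitPlane} := by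
  intro s hs
  left
  have h1 := (re_le_norm s).trans_lt (mem_ball_zero_iff.mp hs)
  simpa using h1

lemma starConvex_one_sub_mem_slitPlane {x : ℝ} (hx : x < 1) :
    StarConvex ℝ (x : ℂ) {s : ℂ | 1 - s ∈ slitPlane} := by
  intro s hs α β hα hβ hαβ
  have h := starConvex_ofReal_slitPlane (sub_pos.mpr hx) hs hα hβ hαβ
  simp only [Set.mem_ofPred_eq]
  convert h using 1
  simp only [real_smul, ofReal_sub, ofReal_one]
  have : (α : ℂ) + β = 1 := by exact_mod_cast hαβ
  linear_combination -this

lemma isPreconnected_one_sub_mem_slitPlane : IsPreconnected {s : ℂ | 1 - s ∈ slitPlane} :=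
  (starConvex_one_sub_mem_slitPlane zero_lt_one).isPathConnected
    (by simp) |>.isConnected.isPreconnected

namespace IsHypergeometricBranch

variable {a b c : ℂ} {f : ℂ → ℂ}

lemma apply_zero (h : IsHypergeometricBranch a b c f) : f 0 = 1 := by
  rw [h.eq_series 0 (by simp), ordinaryHypergeometric_zero]

lemma analyticOnNhd (h : IsHypergeometricBranch a b c f) :
    AnalyticOnNhd ℂ f {s | 1 - s ∈ slitPlane} :=
  h.differentiableOn.analyticOnNhd isOpen_one_sub_mem_slitPlane

lemma iteratedDeriv_zero (h : IsHypergeometricBranch a b c f)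
    (habc : ∀ k : ℕ, (k : ℂ) ≠ -a ∧ (k : ℂ) ≠ -b ∧ (k : ℂ) ≠ -c) (n : ℕ) :
    iteratedDeriv n f 0 =
      (ascPochhammer ℂ n).eval a * (ascPochhammer ℂ n).eval b * ((ascPochhammer ℂ n).eval c)⁻¹ := by
  have hr := ordinaryHypergeometricSeries_radius_eq_one ℂ a b c habc
  have h1 : HasFPowerSeriesAt f (ordinaryHypergeometricSeries ℂ a b c) 0 := by
    have h2 := ((ordinaryHypergeometricSeries ℂ a b c).hasFPowerSeriesOnBall
      (by rw [hr]; exact one_pos)).hasFPowerSeriesAt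
    refine h2.congr ?_
    filter_upwards [Metric.ball_mem_nhds (0 : ℂ) one_pos] with s hs
    rw [h.eq_series s (by simpa using hs)]
    rfl
  have h3 := (h.analyticOnNhd 0 (by simp)).hasFPowerSeriesAt.eq_formalMultilinearSeries h1
  have h4 := congrFun (FormalMultilinearSeries.ofScalars_series_injective ℂ ℂ h3) n
  have hfac : (n.factorial : ℂ) ≠ 0 := by exact_mod_cast n.factorial_ne_zero
  rw [div_eq_iff hfac] at h4
  rw [h4, ordinaryHypergeometricCoefficient]
  field_simp

/-- The hypergeometric equation. -/
lemma ode (h : IsHypergeometricBranch a b c f)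
    (habc : ∀ k : ℕ, (k : ℂ) ≠ -a ∧ (k : ℂ) ≠ -b ∧ (k : ℂ) ≠ -c)
    {s : ℂ} (hs : 1 - s ∈ slitPlane) :
    s * (1 - s) * deriv (deriv f) s + (c - (a + b + 1) * s) * deriv f s - a * b * f s = 0 := by
  have hf := h.analyticOnNhd
  have hA : AnalyticOnNhd ℂ (fun s ↦ s * (1 - s) * deriv (deriv f) s +
      (c - (a + b + 1) * s) * deriv f s - a * b * f s) {s | 1 - s ∈ slitPlane} := by
    intro s hs
    have h0 := hf s hs
    have h1 := h0.deriv
    have h2 := h1.deriv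
    fun_prop
  -- The left side is analytic on the connected set `ℂ ∖ [1, ∞)`, so the recursion of the
  -- coefficients needs to be used only on the unit disc.
  refine hA.eqOn_zero_of_preconnected_of_eventuallyEq_zero isPreconnected_one_sub_mem_slitPlane
    (z₀ := 0) (by simp) ?_ hs
  filter_upwards [Metric.ball_mem_nhds (0 : ℂ) one_pos] with s hs
  refine hypergeometric_ode_of_recursion
    (h.differentiableOn.mono ball_subset_one_sub_mem_slitPlane) (fun n ↦ ?_) (by simpa using hs)
  rw [h.iteratedDeriv_zero habc, h.iteratedDeriv_zero habc, ascPochhammer_succ_eval,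
    ascPochhammer_succ_eval, ascPochhammer_succ_eval, mul_inv]
  have hc : c + n ≠ 0 := fun hc ↦ (habc n).2.2 (by linear_combination hc)
  rw [show (n : ℂ) + c = c + n by ring]
  field_simp
  ring

end IsHypergeometricBranch

end HypergeometricEquation

/-! ### Solutions of the equation along the imaginary axis, and the constants `A`, `B` -/

section AxisSolutions

lemma exists_eq_add_mul_of_hasDerivAt {L M : ℝ → ℂ} {a : ℝ}
    (hL : ∀ y > a, HasDerivAt L (M y) y) (hM : ∀ y > a, HasDerivAt M 0 y) :
    ∃ α β : ℂ, ∀ y > a, L y = α + β * y ∧ M y = β := by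
  have key {f : ℝ → ℂ} (hf : ∀ y > a, HasDerivAt f 0 y) (y : ℝ) (hy : a < y) : f y = f (a + 1) :=
    isOpen_Ioi.is_const_of_deriv_eq_zero isPreconnected_Ioi
      (fun y hy ↦ (hf y hy).differentiableAt.differentiableWithinAt)
      (fun y hy ↦ (hf y hy).deriv) hy (by simp)
  refine ⟨L (a + 1) - M (a + 1) * (a + 1 : ℝ), M (a + 1), fun y hy ↦ ⟨?_, key hM y hy⟩⟩
  have h1 : ∀ y > a, HasDerivAt (fun y : ℝ ↦ L y - M (a + 1) * y) 0 y := by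
    intro y hy
    refine ((hL y hy).sub ((hasDerivAt_id y).ofReal_comp.const_mul (M (a + 1)))).congr_deriv ?_
    simp [key hM y hy]
  have h2 := key h1 y hy
  linear_combination h2

lemma ofReal_mem_cutPlane {x : ℝ} (h0 : 0 < x) (h1 : x < 1) : (x : ℂ) ∈ cutPlane := by
  refine ⟨ofReal_mem_slitPlane.mpr h0, ?_⟩
  rw [← ofReal_one, ← ofReal_sub]
  exact ofReal_mem_slitPlane.mpr (sub_pos.mpr h1)

lemma axisS_mem_cutPlane {y : ℝ} (hy : 1 < y) : (axisS y : ℂ) ∈ cutPlane :=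
  ofReal_mem_cutPlane (axisS_pos hy) (axisS_lt_one hy)

/-- `φ` solves, near each point of the doubly cut plane, the hypergeometric equation with
parameters `1/12, 5/12; 1`. -/
structure IsAxisSolution (φ : ℂ → ℂ) : Prop where
  analyticAt : ∀ s ∈ cutPlane, AnalyticAt ℂ φ s
  ode : ∀ s ∈ cutPlane,
    s * (1 - s) * deriv (deriv φ) s + (1 - 3 / 2 * s) * deriv φ s - 5 / 144 * φ s = 0

/-- The logarithmic slope of a solution along the imaginary axis. -/
noncomputable def axisSlope (v v' : ℂ) (y : ℝ) : ℂ :=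
  -(2 * axisS y * axisW y * axisU y) * v' + 1 / 6 * v * (axisP y / axisU y - axisW y * axisU y)

/-- By the formulas for `U'` and `S'`, the derivative of `φ(S)/U` is `π` times `axisSlope`.
Differentiating again, the formulas for `P'` and `W'` turn the result into a multiple of the
hypergeometric equation at `S(y)`, so it vanishes. -/
lemma IsAxisSolution.exists_eq {φ : ℂ → ℂ} (hφ : IsAxisSolution φ) :
    ∃ α β : ℂ, ∀ y > 1, φ (axisS y) / axisU y = α + β * y ∧
      Real.pi * axisSlope (φ (axisS y)) (deriv φ (axisS y)) y = β := by
  refine exists_eq_add_mul_of_hasDerivAt (fun y hy ↦ ?_) fun y hy ↦ ?_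
  all_goals
    have hy0 : 0 < y := one_pos.trans hy
    have hs := axisS_mem_cutPlane hy
    have hU := (hasDerivAt_axisU hy0).ofReal_comp
    have hW := (hasDerivAt_axisW hy0).ofReal_comp
    have hS := (hasDerivAt_axisS hy0).ofReal_comp
    have hP := (hasDerivAt_axisP hy0).ofReal_comp
    rw [← axisU_pow_four hy0] at hP
    have hφ1 : HasDerivAt (fun y : ℝ ↦ φ (axisS y)) _ y :=
      HasDerivAt.comp (h₂ := φ) y (hφ.analyticAt _ hs).differentiableAt.hasDerivAt hS
    have hφ2 : HasDerivAt (fun y : ℝ ↦ deriv φ (axisS y)) _ y :=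
      HasDerivAt.comp (h₂ := deriv φ) y (hφ.analyticAt _ hs).deriv.differentiableAt.hasDerivAt hS
    have hU0 : (axisU y : ℂ) ≠ 0 := by exact_mod_cast (axisU_pos hy0).ne'
    have hode := hφ.ode _ hs
    have hW2 : (axisS y : ℂ) = 1 - (axisW y : ℂ) ^ 2 := by
      rw [axisS]
      push_cast
      ring
    push_cast at *
  · refine (hφ1.div hU hU0).congr_deriv ?_
    rw [axisSlope]
    field_simp
    ring
  · have h1 := (((((hS.const_mul 2).mul hW).mul hU).neg.mul hφ2).add
      ((hφ1.const_mul (1 / 6)).mul ((hP.div hU hU0).sub (hW.mul hU)))).const_mul (Real.pi : ℂ)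
    refine h1.congr_deriv ?_
    simp only [Pi.mul_apply, Pi.neg_apply, Pi.div_apply, Pi.sub_apply]
    generalize deriv (deriv φ) (axisS y) = v₂ at hode ⊢
    generalize deriv φ (axisS y) = v₁ at hode ⊢
    generalize φ (axisS y) = v at hode ⊢
    rw [hW2] at hode ⊢
    generalize (axisW y : ℂ) = W at hode ⊢
    generalize (axisU y : ℂ) = U at hU0 ⊢
    field_simp
    linear_combination 1728 * Real.pi ^ 2 * U ^ 4 * (1 - W ^ 2) * hode

/-- The even solution `₂F₁(1/12, 5/12; 1/2; ·)` of the equation at `s = 1`. -/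
noncomputable def chiHalf : ℂ → ℂ := hypergeometricBranch (1 / 12) (5 / 12) (1 / 2)

lemma isHypergeometricBranch_chi₁ : IsHypergeometricBranch (1 / 12) (5 / 12) 1 chi₁ :=
  isHypergeometricBranch_hypergeometricBranch _ (by norm_num) (by norm_num)

lemma isHypergeometricBranch_chiHalf : IsHypergeometricBranch (1 / 12) (5 / 12) (1 / 2) chiHalf :=
  isHypergeometricBranch_hypergeometricBranch _ (by norm_num) (by norm_num)

lemma natCast_ne_neg_of_re_pos {x : ℂ} (hx : 0 < x.re) (k : ℕ) : (k : ℂ) ≠ -x := by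
  intro h
  have h1 := congrArg re h
  have h2 : (0 : ℝ) ≤ k := k.cast_nonneg
  simp at h1
  linarith

lemma chi₁_ode {s : ℂ} (hs : 1 - s ∈ slitPlane) :
    s * (1 - s) * deriv (deriv chi₁) s + (1 - 3 / 2 * s) * deriv chi₁ s - 5 / 144 * chi₁ s = 0 := by
  have h := isHypergeometricBranch_chi₁.ode (fun k ↦ ⟨?_, ?_, ?_⟩) hs
  · linear_combination h
  · exact natCast_ne_neg_of_re_pos (by norm_num) k
  · exact natCast_ne_neg_of_re_pos (by norm_num) k
  · exact natCast_ne_neg_of_re_pos (by norm_num) k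

lemma chiHalf_ode {x : ℂ} (hx : 1 - x ∈ slitPlane) :
    x * (1 - x) * deriv (deriv chiHalf) x + (1 / 2 - 3 / 2 * x) * deriv chiHalf x
      - 5 / 144 * chiHalf x = 0 := by
  have h := isHypergeometricBranch_chiHalf.ode (fun k ↦ ⟨?_, ?_, ?_⟩) hx
  · linear_combination h
  · exact natCast_ne_neg_of_re_pos (by norm_num) k
  · exact natCast_ne_neg_of_re_pos (by norm_num) k
  · exact natCast_ne_neg_of_re_pos (by norm_num) k

lemma analyticAt_chi₁ {s : ℂ} (hs : 1 - s ∈ slitPlane) : AnalyticAt ℂ chi₁ s :=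
  isHypergeometricBranch_chi₁.analyticOnNhd s hs

lemma analyticAt_chiHalf {s : ℂ} (hs : 1 - s ∈ slitPlane) : AnalyticAt ℂ chiHalf s :=
  isHypergeometricBranch_chiHalf.analyticOnNhd s hs

lemma one_sub_one_sub_mem_slitPlane {s : ℂ} (hs : s ∈ slitPlane) : 1 - (1 - s) ∈ slitPlane := by
  rwa [sub_sub_cancel]

lemma isAxisSolution_chi₁ : IsAxisSolution chi₁ where
  analyticAt _ hs := analyticAt_chi₁ hs.2
  ode _ hs := chi₁_ode hs.2

lemma isAxisSolution_chiHalf_one_sub : IsAxisSolution fun s ↦ chiHalf (1 - s) where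
  analyticAt s hs := (analyticAt_chiHalf (one_sub_one_sub_mem_slitPlane hs.1)).comp
    (f := fun s ↦ 1 - s) (by fun_prop)
  ode s hs := by
    have h := chiHalf_ode (one_sub_one_sub_mem_slitPlane hs.1)
    have h1 : deriv (fun s ↦ chiHalf (1 - s)) = fun s ↦ -deriv chiHalf (1 - s) := by
      ext s
      exact deriv_comp_const_sub chiHalf 1 s
    have h2 : deriv (fun s ↦ -deriv chiHalf (1 - s)) s = deriv (deriv chiHalf) (1 - s) := by
      rw [deriv.fun_neg, deriv_comp_const_sub (deriv chiHalf) 1 s, neg_neg]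
    rw [h1, h2]
    linear_combination h

/-- On the imaginary axis, `χ₁` is the fourth root of `Q`. -/
lemma chi₁_axisS {y : ℝ} (hy : 1 < y) : chi₁ (axisS y) = axisU y := by
  obtain ⟨α, β, h⟩ := isAxisSolution_chi₁.exists_eq
  have hlim : Tendsto (fun y : ℝ ↦ α + β * y) atTop (𝓝 1) := by
    have h0 : Tendsto (fun y ↦ chi₁ (axisS y)) atTop (𝓝 1) := by
      have h1 := (analyticAt_chi₁ (s := 0) (by simp)).continuousAt.tendsto
      rw [isHypergeometricBranch_chi₁.apply_zero, ← ofReal_zero] at h1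
      exact h1.comp ((continuous_ofReal.tendsto 0).comp tendsto_axisS_atTop)
    have h1 : Tendsto (fun y ↦ (axisU y : ℂ)) atTop (𝓝 1) := by
      exact_mod_cast (continuous_ofReal.tendsto 1).comp tendsto_axisU_atTop
    have h2 := h0.div h1 one_ne_zero
    rw [div_one] at h2
    refine h2.congr' ?_
    filter_upwards [eventually_gt_atTop 1] with y hy using (h y hy).1
  -- An affine function with a finite limit at infinity is constant: compare it at `y + 1` and at
  -- `y`.
  have hβ : β = 0 := by
    have h1 := (hlim.comp (tendsto_atTop_add_const_right atTop (1 : ℝ) tendsto_id)).sub hlim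
    rw [sub_self] at h1
    refine tendsto_nhds_unique (tendsto_const_nhds (x := β) (f := atTop (α := ℝ))) (h1.congr ?_)
    intro y
    simp
    ring
  have hα : α = 1 := by
    simp only [hβ, zero_mul, add_zero] at hlim
    exact tendsto_nhds_unique tendsto_const_nhds hlim
  have h1 := (h y hy).1
  have hU : (axisU y : ℂ) ≠ 0 := by exact_mod_cast (axisU_pos (one_pos.trans hy)).ne'
  rw [hβ, hα, div_eq_iff hU] at h1
  simpa using h1

lemma continuousAt_axis {f : ℝ → ℝ} {f' y : ℝ} (h : HasDerivAt f f' y) :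
    ContinuousAt (fun y ↦ (f y : ℂ)) y :=
  continuous_ofReal.continuousAt.comp h.continuousAt

/-- On the imaginary axis, the even solution at `s = 1`. -/
lemma chiHalf_one_sub_axisS {y : ℝ} (hy : 1 < y) :
    chiHalf (1 - axisS y) = (1 + y) / (2 * axisU 1) * axisU y := by
  obtain ⟨α, β, h⟩ := isAxisSolution_chiHalf_one_sub.exists_eq
  have hU1 : (axisU 1 : ℂ) ≠ 0 := by exact_mod_cast (axisU_pos one_pos).ne'
  have hpi : (Real.pi : ℂ) ≠ 0 := by exact_mod_cast Real.pi_ne_zero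
  have cU := continuousAt_axis (hasDerivAt_axisU one_pos)
  have cW := continuousAt_axis (hasDerivAt_axisW one_pos)
  have cS := continuousAt_axis (hasDerivAt_axisS one_pos)
  have cP := continuousAt_axis (hasDerivAt_axisP one_pos)
  have h0 : (1 : ℂ) - axisS 1 = 0 := by simp [axisS_one]
  have c0 : ContinuousAt (fun y ↦ chiHalf (1 - axisS y)) 1 := by
    refine ContinuousAt.comp (g := chiHalf) ?_ (continuousAt_const.sub cS)
    rw [h0]
    exact (analyticAt_chiHalf (by simp)).continuousAt
  have c1 : ContinuousAt (fun y ↦ deriv chiHalf (1 - axisS y)) 1 := by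
    refine ContinuousAt.comp (g := deriv chiHalf) ?_ (continuousAt_const.sub cS)
    rw [h0]
    exact (analyticAt_chiHalf (by simp)).deriv.continuousAt
  have cL : ContinuousAt (fun y ↦ chiHalf (1 - axisS y) / axisU y) 1 := c0.div cU hU1
  have cM : ContinuousAt
      (fun y ↦ axisSlope (chiHalf (1 - axisS y)) (-deriv chiHalf (1 - axisS y)) y) 1 :=
    (((continuousAt_const.mul cS).mul cW).mul cU).neg.mul c1.neg |>.add
      ((continuousAt_const.mul c0).mul ((cP.div cU hU1).sub (cW.mul cU)))
  -- The point `s = 1` is not in the cut plane, but `chiHalf` is analytic at `1 - s = 0`, so the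
  -- value and the slope extend continuously to `y = 1`. There `S = 1`, `W = 0` and `P = 3/π`, so
  -- the slope is `π · (1/6) · (3/π) / U(1)`.
  have hα : 1 / (axisU 1 : ℂ) = α + β := by
    have h1 := cL.tendsto.mono_left (nhdsWithin_le_nhds (s := Set.Ioi 1))
    have h2 : Tendsto (fun y : ℝ ↦ α + β * y) (𝓝[>] 1) (𝓝 (α + β * (1 : ℝ))) :=
      (Continuous.tendsto (by fun_prop) 1).mono_left nhdsWithin_le_nhds
    have h3 := tendsto_nhds_unique (h1.congr' ?_) h2
    · rwa [h0, isHypergeometricBranch_chiHalf.apply_zero, ofReal_one, mul_one] at h3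
    · filter_upwards [self_mem_nhdsWithin] with y hy using (h y hy).1
  have hβ : 1 / (2 * axisU 1 : ℂ) = β := by
    have h1 := cM.tendsto.mono_left (nhdsWithin_le_nhds (s := Set.Ioi 1))
    have h3 := tendsto_nhds_unique ((h1.const_mul (Real.pi : ℂ)).congr' ?_)
      (tendsto_const_nhds (x := β))
    · rw [axisSlope, h0, isHypergeometricBranch_chiHalf.apply_zero, axisW_one, axisP_one] at h3
      rw [← h3]
      push_cast
      field_simp
      ring
    · filter_upwards [self_mem_nhdsWithin] with y hy
      rw [← (h y hy).2, deriv_comp_const_sub]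
  have hU : (axisU y : ℂ) ≠ 0 := by exact_mod_cast (axisU_pos (one_pos.trans hy)).ne'
  have h1 := (h y hy).1
  rw [div_eq_iff hU] at h1
  rw [h1, ← hβ, show α = 1 / (2 * axisU 1 : ℂ) by
    rw [← hβ] at hα
    linear_combination -hα]
  field_simp

/-- Let `y → 1` from the right in `χ₁(S(y)) = U(y)`; then `S(y) → 1` from the left and Gauss's
theorem applies. -/
lemma axisU_one :
    (axisU 1 : ℂ) = Gamma (1 / 2) / (Gamma (11 / 12) * Gamma (7 / 12)) := by
  have h1 := tendsto_ordinaryHypergeometric_one (a := 1 / 12) (b := 5 / 12) (c := 1)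
    (by norm_num) (by norm_num) (by norm_num)
  have hS : Tendsto axisS (𝓝[>] 1) (𝓝[<] 1) := by
    refine tendsto_nhdsWithin_of_tendsto_nhds_of_eventually_within _ ?_ ?_
    · have := (hasDerivAt_axisS one_pos).continuousAt.tendsto
      rw [axisS_one] at this
      exact this.mono_left nhdsWithin_le_nhds
    · filter_upwards [self_mem_nhdsWithin] with y hy using axisS_lt_one hy
  have hU := (continuousAt_axis (hasDerivAt_axisU one_pos)).tendsto.mono_left
    (nhdsWithin_le_nhds (s := Set.Ioi 1))
  have h2 := tendsto_nhds_unique (hU.congr' ?_) (h1.comp hS)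
  · rw [h2]
    push_cast
    norm_num
  · filter_upwards [self_mem_nhdsWithin] with y hy
    rw [← chi₁_axisS hy, isHypergeometricBranch_chi₁.eq_series]
    · simp
    · rw [norm_real, Real.norm_of_nonneg (axisS_pos hy).le]
      exact axisS_lt_one hy

/-- The reflection formula at `1/12`, `5/12` and `1/2`, together with `sin(π/12) sin(5π/12) =
sin(π/6)/2 = 1/4`. -/
lemma constA_eq : constA = 2 * I * axisU 1 := by
  have h1 := Complex.Gamma_mul_Gamma_one_sub (1 / 12)
  have h2 := Complex.Gamma_mul_Gamma_one_sub (5 / 12)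
  have h3 := Complex.Gamma_mul_Gamma_one_sub (1 / 2)
  have hs : sin ((Real.pi : ℂ) * (1 / 12)) * sin ((Real.pi : ℂ) * (5 / 12)) = 1 / 4 := by
    rw [show (Real.pi : ℂ) * (5 / 12) = Real.pi / 2 - Real.pi * (1 / 12) by ring,
      Complex.sin_pi_div_two_sub]
    have h := Complex.sin_two_mul ((Real.pi : ℂ) * (1 / 12))
    rw [show 2 * ((Real.pi : ℂ) * (1 / 12)) = ((Real.pi / 6 : ℝ) : ℂ) by push_cast; ring,
      ← ofReal_sin, Real.sin_pi_div_six] at h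
    push_cast at h
    linear_combination -h / 2
  rw [show (1 : ℂ) - 1 / 12 = 11 / 12 by norm_num] at h1
  rw [show (1 : ℂ) - 5 / 12 = 7 / 12 by norm_num] at h2
  rw [show (1 : ℂ) - 1 / 2 = 1 / 2 by norm_num, show (Real.pi : ℂ) * (1 / 2) = Real.pi / 2 by ring,
    Complex.sin_pi_div_two, div_one] at h3
  have hpi : (Real.pi : ℂ) ≠ 0 := by exact_mod_cast Real.pi_ne_zero
  have hs1 : sin ((Real.pi : ℂ) * (1 / 12)) ≠ 0 := fun h ↦ by norm_num [h] at hs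
  have hs2 : sin ((Real.pi : ℂ) * (5 / 12)) ≠ 0 := fun h ↦ by norm_num [h] at hs
  have g1 : Gamma (11 / 12) ≠ 0 := Gamma_ne_zero_of_re_pos (by norm_num)
  have g2 : Gamma (7 / 12) ≠ 0 := Gamma_ne_zero_of_re_pos (by norm_num)
  have g3 : Gamma (1 / 2) ≠ 0 := Gamma_ne_zero_of_re_pos (by norm_num)
  rw [constA, axisU_one]
  rw [eq_div_iff hs1] at h1
  rw [eq_div_iff hs2] at h2
  have h4 : Gamma (1 / 12) * Gamma (5 / 12) * (Gamma (11 / 12) * Gamma (7 / 12)) =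
      4 * (Real.pi * (Gamma (1 / 2) * Gamma (1 / 2))) := by
    rw [h3]
    linear_combination 4 * Gamma (5 / 12) * Gamma (7 / 12) * sin ((Real.pi : ℂ) * (5 / 12)) * h1 +
      4 * (Real.pi : ℂ) * h2 -
      4 * Gamma (1 / 12) * Gamma (11 / 12) * Gamma (5 / 12) * Gamma (7 / 12) * hs
  generalize Gamma (1 / 12) = a at *
  generalize Gamma (5 / 12) = b at *
  generalize Gamma (11 / 12) = c at *
  generalize Gamma (7 / 12) = d at *
  generalize Gamma (1 / 2) = e at *
  field_simp
  linear_combination h4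

lemma chi₂_eq (s : ℂ) : chi₂ s = constA * chiHalf (1 - s) - I * chi₁ s := by
  simp [chi₂, chiHalf, constB, sub_eq_add_neg]

/-- On the imaginary axis, `z(s)` is the inverse of `(Q³ - R²) / Q³`. -/
lemma zMap_axisS {y : ℝ} (hy : 1 < y) : zMap (axisS y) = I * y := by
  have hU : (axisU y : ℂ) ≠ 0 := by exact_mod_cast (axisU_pos (one_pos.trans hy)).ne'
  have hU1 : (axisU 1 : ℂ) ≠ 0 := by exact_mod_cast (axisU_pos one_pos).ne'
  -- This is what `A` and `B` are chosen for: `2i U(1) · (1 + y)/(2 U(1)) - i = iy`.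
  rw [zMap, chi₂_eq, chi₁_axisS hy, chiHalf_one_sub_axisS hy, constA_eq]
  field_simp
  ring

end AxisSolutions

/-! ### The identity theorem along the axis; Wronskian and derivative of `χ₁` there -/

section IdentityTheorem

/-- The holomorphic inverse function theorem. -/
lemma AnalyticAt.exists_analytic_inverse {h : ℂ → ℂ} {x : ℂ} (hh : AnalyticAt ℂ h x)
    (h' : deriv h x ≠ 0) :
    ∃ k : ℂ → ℂ, AnalyticAt ℂ k (h x) ∧ k (h x) = x ∧ (∀ᶠ w in 𝓝 x, k (h w) = w) ∧
      ∀ᶠ w in 𝓝 (h x), h (k w) = w :=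
  ⟨_, hh.analyticAt_localInverse h',
    (hh.hasStrictDerivAt.eventually_left_inverse h').self_of_nhds,
    hh.hasStrictDerivAt.eventually_left_inverse h',
    hh.hasStrictDerivAt.eventually_right_inverse h'⟩

lemma isOpen_cutPlane : IsOpen cutPlane :=
  isOpen_slitPlane.inter isOpen_one_sub_mem_slitPlane

lemma starConvex_cutPlane {x : ℝ} (h0 : 0 < x) (h1 : x < 1) : StarConvex ℝ (x : ℂ) cutPlane :=
  (starConvex_ofReal_slitPlane h0).inter (starConvex_one_sub_mem_slitPlane h1)

/-- The cut plane and the ball are both star-shaped about the real point `x`. -/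
lemma isPreconnected_cutPlane_inter_ball {x r : ℝ} {c : ℂ} (h0 : 0 < x) (h1 : x < 1)
    (hx : (x : ℂ) ∈ Metric.ball c r) : IsPreconnected (cutPlane ∩ Metric.ball c r) :=
  (((starConvex_cutPlane h0 h1).inter ((convex_ball c r).starConvex hx)).isPathConnected
    ⟨ofReal_mem_cutPlane h0 h1, hx⟩).isConnected.isPreconnected

lemma isPreconnected_cutPlane : IsPreconnected cutPlane :=
  ((starConvex_cutPlane (x := 1 / 2) (by norm_num) (by norm_num)).isPathConnected
    (ofReal_mem_cutPlane (by norm_num) (by norm_num))).isConnected.isPreconnected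

lemma ne_zero_of_mem_cutPlane {s : ℂ} (hs : s ∈ cutPlane) : s ≠ 0 := slitPlane_ne_zero hs.1

lemma cpow_half_sq (x : ℂ) : (x ^ (1 / 2 : ℂ)) ^ 2 = x := by
  rw [← cpow_nat_mul]
  norm_num

lemma cpow_half_ne_zero {x : ℂ} (hx : x ≠ 0) : x ^ (1 / 2 : ℂ) ≠ 0 := fun h ↦ by
  have := cpow_half_sq x
  rw [h] at this
  exact hx (by simpa using this.symm)

lemma analyticAt_one_sub_cpow_half {s : ℂ} (hs : 1 - s ∈ slitPlane) :
    AnalyticAt ℂ (fun s : ℂ ↦ (1 - s) ^ (1 / 2 : ℂ)) s :=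
  AnalyticAt.cpow (by fun_prop) (by fun_prop) hs

lemma one_sub_axisS_cpow {y : ℝ} (hy : 1 < y) :
    (1 - (axisS y : ℂ)) ^ (1 / 2 : ℂ) = axisW y := by
  have h : (1 - (axisS y : ℂ)) = ((axisW y ^ 2 : ℝ) : ℂ) := by
    rw [axisS]
    push_cast
    ring
  rw [h, show (1 / 2 : ℂ) = ((1 / 2 : ℝ) : ℂ) by push_cast; rfl,
    ← ofReal_cpow (by positivity), ← Real.sqrt_eq_rpow, Real.sqrt_sq (axisW_pos hy).le]

/-- The identity theorem along the image of the imaginary axis. -/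
lemma eqOn_of_eq_axisS {U : Set ℂ} {F H : ℂ → ℂ} (hF : AnalyticOnNhd ℂ F U)
    (hH : AnalyticOnNhd ℂ H U) (hU : IsPreconnected U) {y₀ : ℝ} (hy₀ : 1 < y₀)
    (hmem : (axisS y₀ : ℂ) ∈ U) (h : ∀ᶠ y in 𝓝 y₀, F (axisS y) = H (axisS y)) :
    Set.EqOn F H U := by
  refine hF.eqOn_of_preconnected_of_frequently_eq hH hU hmem ?_
  have h0 := one_pos.trans hy₀
  have hd : HasDerivAt (fun y : ℝ ↦ (axisS y : ℂ)) _ y₀ := (hasDerivAt_axisS h0).ofReal_comp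
  have hne : ((-(2 * Real.pi * axisW y₀ * axisS y₀ * axisU y₀ ^ 2) : ℝ) : ℂ) ≠ 0 := by
    have := axisW_pos hy₀
    have := axisS_pos hy₀
    have := axisU_pos h0
    have := Real.pi_pos
    rw [ofReal_ne_zero, neg_ne_zero]
    positivity
  -- The curve `y ↦ S(y)` has nonzero velocity, so its points near `y₀` differ from `S(y₀)` and
  -- accumulate there.
  exact (hd.tendsto_nhdsNE hne).frequently (h.filter_mono nhdsWithin_le_nhds).frequently

lemma analyticAt_chi₂ {s : ℂ} (hs : s ∈ cutPlane) : AnalyticAt ℂ chi₂ s := by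
  have h1 := isAxisSolution_chiHalf_one_sub.analyticAt s hs
  have h2 := analyticAt_chi₁ hs.2
  rw [show chi₂ = fun s ↦ constA * chiHalf (1 - s) - I * chi₁ s from funext chi₂_eq]
  fun_prop

lemma deriv_chi₁_axisS {y : ℝ} (hy : 1 < y) :
    12 * axisW y * axisS y * axisU y * deriv chi₁ (axisS y) =
      axisP y - axisW y * axisU y ^ 2 := by
  have h0 := one_pos.trans hy
  have h1 : HasDerivAt (fun y : ℝ ↦ chi₁ (axisS y)) _ y := HasDerivAt.comp (h₂ := chi₁) y
    (analyticAt_chi₁ (axisS_mem_cutPlane hy).2).differentiableAt.hasDerivAt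
    (hasDerivAt_axisS h0).ofReal_comp
  have h2 : HasDerivAt (fun y : ℝ ↦ chi₁ (axisS y)) _ y :=
    ((hasDerivAt_axisU h0).ofReal_comp).congr_of_eventuallyEq (by
      filter_upwards [lt_mem_nhds hy] with t ht using chi₁_axisS ht)
  have h3 := h1.unique h2
  have hpi : (Real.pi : ℂ) ≠ 0 := by exact_mod_cast Real.pi_ne_zero
  have hU : (axisU y : ℂ) ≠ 0 := by exact_mod_cast (axisU_pos h0).ne'
  push_cast at h3
  refine mul_left_cancel₀ (mul_ne_zero hpi hU) ?_
  linear_combination -6 * h3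

/-- Differentiate `χ₂(S) = iy χ₁(S)`: the Wronskian times `S'` equals `i χ₁² = i U²`, while `S' =
-2π W S U²`. -/
lemma wronskian_axisS {y : ℝ} (hy : 1 < y) :
    (chi₁ (axisS y) * deriv chi₂ (axisS y) - chi₂ (axisS y) * deriv chi₁ (axisS y)) *
      (axisS y * axisW y) = (2 * Real.pi * I)⁻¹ := by
  have h0 := one_pos.trans hy
  have hs := axisS_mem_cutPlane hy
  have hS := (hasDerivAt_axisS h0).ofReal_comp
  have h1 : HasDerivAt (fun y : ℝ ↦ chi₁ (axisS y)) _ y := HasDerivAt.comp (h₂ := chi₁) y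
    (analyticAt_chi₁ hs.2).differentiableAt.hasDerivAt hS
  have h2 : HasDerivAt (fun y : ℝ ↦ chi₂ (axisS y)) _ y := HasDerivAt.comp (h₂ := chi₂) y
    (analyticAt_chi₂ hs).differentiableAt.hasDerivAt hS
  have hmul {y : ℝ} (hy : 1 < y) : chi₂ (axisS y) = I * y * chi₁ (axisS y) := by
    have hU : (axisU y : ℂ) ≠ 0 := by exact_mod_cast (axisU_pos (one_pos.trans hy)).ne'
    have h := zMap_axisS hy
    rwa [zMap, chi₁_axisS hy, div_eq_iff hU, ← chi₁_axisS hy] at h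
  have h3 : HasDerivAt (fun y : ℝ ↦ chi₂ (axisS y)) _ y :=
    (((hasDerivAt_id y).ofReal_comp.const_mul I).mul h1).congr_of_eventuallyEq (by
      filter_upwards [lt_mem_nhds hy] with t ht using hmul ht)
  have h4 := h2.unique h3
  have hpi : (Real.pi : ℂ) ≠ 0 := by exact_mod_cast Real.pi_ne_zero
  have hU : (axisU y : ℂ) ≠ 0 := by exact_mod_cast (axisU_pos h0).ne'
  rw [hmul hy]
  rw [chi₁_axisS hy] at h4 ⊢
  push_cast at h4
  simp only [id_eq, mul_one] at h4
  field_simp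
  refine mul_right_cancel₀ hU ?_
  linear_combination -I * h4 - axisU y * I_sq

end IdentityTheorem

/-! ### The region where `Im z(s) > 0`, the parametrization on it, and the cusps -/

section UpperPart

open scoped MatrixGroups

lemma wronskian_eq {s : ℂ} (hs : s ∈ cutPlane) :
    (chi₁ s * deriv chi₂ s - chi₂ s * deriv chi₁ s) * (s * (1 - s) ^ (1 / 2 : ℂ)) =
      (2 * Real.pi * I)⁻¹ := by
  refine eqOn_of_eq_axisS (y₀ := 2)
    (F := fun s ↦ (chi₁ s * deriv chi₂ s - chi₂ s * deriv chi₁ s) * (s * (1 - s) ^ (1 / 2 : ℂ)))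
    (H := fun _ ↦ (2 * Real.pi * I)⁻¹)
    (fun s hs ↦ ?_) analyticOnNhd_const isPreconnected_cutPlane one_lt_two
    (axisS_mem_cutPlane one_lt_two) ?_ hs
  · have h1 := analyticAt_chi₁ hs.2
    have h2 := analyticAt_chi₂ hs
    have h3 := h1.deriv
    have h4 := h2.deriv
    have h5 := analyticAt_one_sub_cpow_half hs.2
    fun_prop
  · filter_upwards [lt_mem_nhds one_lt_two] with y hy
    rw [one_sub_axisS_cpow hy, wronskian_axisS hy]

lemma wronskian_ne_zero {s : ℂ} (hs : s ∈ cutPlane) :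
    chi₁ s * deriv chi₂ s - chi₂ s * deriv chi₁ s ≠ 0 := by
  intro h
  have h1 := wronskian_eq hs
  rw [h, zero_mul] at h1
  exact inv_ne_zero two_pi_I_ne_zero h1.symm

/-- The part of the doubly cut plane that `z(s)` maps into the upper half-plane. -/
def upperPart : Set ℂ := {s | s ∈ cutPlane ∧ chi₁ s ≠ 0 ∧ 0 < (zMap s).im}

lemma analyticAt_zMap {s : ℂ} (hs : s ∈ cutPlane) (h : chi₁ s ≠ 0) : AnalyticAt ℂ zMap s :=
  (analyticAt_chi₂ hs).div (analyticAt_chi₁ hs.2) h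

lemma eventually_mem_upperPart {s : ℂ} (hs : s ∈ upperPart) : ∀ᶠ w in 𝓝 s, w ∈ upperPart := by
  filter_upwards [isOpen_cutPlane.mem_nhds hs.1,
    (analyticAt_chi₁ hs.1.2).continuousAt.eventually_ne hs.2.1,
    (continuous_im.continuousAt.comp (analyticAt_zMap hs.1 hs.2.1).continuousAt).eventually
      (lt_mem_nhds hs.2.2)] with w h1 h2 h3
  exact ⟨h1, h2, h3⟩

lemma isOpen_upperPart : IsOpen upperPart :=
  isOpen_iff_mem_nhds.mpr fun _ hs ↦ eventually_mem_upperPart hs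

lemma axisS_mem_upperPart {y : ℝ} (hy : 1 < y) : (axisS y : ℂ) ∈ upperPart := by
  refine ⟨axisS_mem_cutPlane hy, ?_, ?_⟩
  · rw [chi₁_axisS hy]
    exact_mod_cast (axisU_pos (one_pos.trans hy)).ne'
  · rw [zMap_axisS hy]
    simpa using one_pos.trans hy

lemma isOpen_im_pos : IsOpen {z : ℂ | 0 < z.im} := isOpen_lt continuous_const continuous_im

lemma analyticAt_of_hasDerivAt_im_pos {f : ℂ → ℂ} {f' : ℂ → ℂ}
    (h : ∀ z : ℂ, 0 < z.im → HasDerivAt f (f' z) z) {z : ℂ} (hz : 0 < z.im) : AnalyticAt ℂ f z :=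
  DifferentiableOn.analyticAt (s := {z : ℂ | 0 < z.im})
    (fun w hw ↦ (h w hw).differentiableAt.differentiableWithinAt) (isOpen_im_pos.mem_nhds hz)

lemma analyticAt_eisP {z : ℂ} (hz : 0 < z.im) : AnalyticAt ℂ eisP z :=
  analyticAt_of_hasDerivAt_im_pos (fun _ ↦ hasDerivAt_eisP) hz

lemma analyticAt_eisQ {z : ℂ} (hz : 0 < z.im) : AnalyticAt ℂ eisQ z :=
  analyticAt_of_hasDerivAt_im_pos (fun _ ↦ hasDerivAt_eisQ) hz

lemma analyticAt_eisR {z : ℂ} (hz : 0 < z.im) : AnalyticAt ℂ eisR z :=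
  analyticAt_of_hasDerivAt_im_pos (fun _ ↦ hasDerivAt_eisR) hz

/-- The set `U` is left general because the formula is needed twice: on one component of
`upperPart`, where it enters the continuation argument, and on the whole cut plane once that
argument is complete. -/
lemma eisQ_zMap_of_preconnected {U : Set ℂ} (hU : IsPreconnected U) (hsub : U ⊆ upperPart)
    (hmem : (axisS 2 : ℂ) ∈ U) {s : ℂ} (hs : s ∈ U) : eisQ (zMap s) = chi₁ s ^ 4 := by
  refine eqOn_of_eq_axisS (y₀ := 2) (F := fun s ↦ eisQ (zMap s)) (H := fun s ↦ chi₁ s ^ 4)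
    (fun s hs ↦ ?_) (fun s hs ↦ ?_) hU one_lt_two hmem ?_ hs
  · have h := hsub hs
    exact (analyticAt_eisQ h.2.2).comp (analyticAt_zMap h.1 h.2.1)
  · exact (analyticAt_chi₁ (hsub hs).1.2).pow 4
  · filter_upwards [lt_mem_nhds one_lt_two] with y hy
    rw [zMap_axisS hy, chi₁_axisS hy, eisQ_I_mul, ← axisU_pow_four (one_pos.trans hy)]
    push_cast
    rfl

lemma eisR_zMap_of_preconnected {U : Set ℂ} (hU : IsPreconnected U) (hsub : U ⊆ upperPart)
    (hmem : (axisS 2 : ℂ) ∈ U) {s : ℂ} (hs : s ∈ U) :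
    eisR (zMap s) = (1 - s) ^ (1 / 2 : ℂ) * chi₁ s ^ 6 := by
  refine eqOn_of_eq_axisS (y₀ := 2) (F := fun s ↦ eisR (zMap s))
    (H := fun s ↦ (1 - s) ^ (1 / 2 : ℂ) * chi₁ s ^ 6)
    (fun s hs ↦ ?_) (fun s hs ↦ ?_) hU one_lt_two hmem ?_ hs
  · have h := hsub hs
    exact (analyticAt_eisR h.2.2).comp (analyticAt_zMap h.1 h.2.1)
  · exact (analyticAt_one_sub_cpow_half (hsub hs).1.2).mul ((analyticAt_chi₁ (hsub hs).1.2).pow 6)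
  · filter_upwards [lt_mem_nhds one_lt_two] with y hy
    rw [zMap_axisS hy, chi₁_axisS hy, eisR_I_mul, one_sub_axisS_cpow hy,
      axisR_eq_mul (one_pos.trans hy)]
    push_cast
    rfl

lemma eisP_zMap_of_preconnected {U : Set ℂ} (hU : IsPreconnected U) (hsub : U ⊆ upperPart)
    (hmem : (axisS 2 : ℂ) ∈ U) {s : ℂ} (hs : s ∈ U) :
    eisP (zMap s) =
      (1 - s) ^ (1 / 2 : ℂ) * (chi₁ s ^ 2 + 12 * s * chi₁ s * deriv chi₁ s) := by
  refine eqOn_of_eq_axisS (y₀ := 2) (F := fun s ↦ eisP (zMap s))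
    (H := fun s ↦ (1 - s) ^ (1 / 2 : ℂ) * (chi₁ s ^ 2 + 12 * s * chi₁ s * deriv chi₁ s))
    (fun s hs ↦ ?_) (fun s hs ↦ ?_) hU one_lt_two hmem ?_ hs
  · have h := hsub hs
    exact (analyticAt_eisP h.2.2).comp (analyticAt_zMap h.1 h.2.1)
  · have h1 := analyticAt_one_sub_cpow_half (hsub hs).1.2
    have h2 := analyticAt_chi₁ (hsub hs).1.2
    have h3 := h2.deriv
    fun_prop
  · filter_upwards [lt_mem_nhds one_lt_two] with y hy
    rw [zMap_axisS hy, chi₁_axisS hy, eisP_I_mul, one_sub_axisS_cpow hy]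
    linear_combination -deriv_chi₁_axisS hy

lemma eisTriangle_zMap_of_preconnected {U : Set ℂ} (hU : IsPreconnected U) (hsub : U ⊆ upperPart)
    (hmem : (axisS 2 : ℂ) ∈ U) {s : ℂ} (hs : s ∈ U) : eisTriangle (zMap s) = s := by
  have hne := (hsub hs).2.1
  rw [eisTriangle, eisQ_zMap_of_preconnected hU hsub hmem hs,
    eisR_zMap_of_preconnected hU hsub hmem hs, mul_pow, cpow_half_sq]
  field_simp
  ring

/-- Every real interval contains a cusp, the limit of a geodesic along which the triangle
function tends to `0`. -/
lemma exists_tendsto_eisTriangle_zero (x : ℝ) {δ : ℝ} (hδ : 0 < δ) :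
    ∃ (r : ℝ) (g : ℝ → ℂ), |r - x| < δ ∧ (∀ᶠ t in atTop, 0 < (g t).im) ∧
      Tendsto g atTop (𝓝 (r : ℂ)) ∧ Tendsto (fun t ↦ eisTriangle (g t)) atTop (𝓝 0) := by
  obtain ⟨ρ, hρ1, hρ2⟩ := exists_rat_btwn (show x < x + δ by linarith)
  have hcop : IsCoprime ρ.num (ρ.den : ℤ) := by
    rw [Int.isCoprime_iff_gcd_eq_one]
    exact ρ.reduced
  -- A matrix with first column `(num ρ, den ρ)` sends `i∞` to `ρ`; the path sought is the image of
  -- the imaginary axis.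
  obtain ⟨γ, h0, h1⟩ := hcop.exists_SL2_col 0
  refine ⟨ρ, fun t ↦ (γ 0 0 * (I * t) + γ 0 1) / (γ 1 0 * (I * t) + γ 1 1), ?_, ?_, ?_, ?_⟩
  · rw [abs_lt]
    constructor <;> linarith
  all_goals
    have hcoe {t : ℝ} (ht : 0 < t) : (γ 0 0 * (I * t) + γ 0 1) / (γ 1 0 * (I * t) + γ 1 1) =
        ((γ • (⟨I * t, by simpa⟩ : UpperHalfPlane) : UpperHalfPlane) : ℂ) := by
      rw [UpperHalfPlane.coe_specialLinearGroup_apply]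
      simp
  · filter_upwards [eventually_gt_atTop 0] with t ht
    rw [hcoe ht]
    exact UpperHalfPlane.im_pos _
  · have hinv : Tendsto (fun t : ℝ ↦ ((t : ℂ))⁻¹) atTop (𝓝 0) := by
      have := (continuous_ofReal.tendsto 0).comp tendsto_inv_atTop_zero
      exact this.congr (fun t ↦ by simp)
    have hden : (ρ.den : ℂ) ≠ 0 := by exact_mod_cast ρ.den_ne_zero
    have hlim : Tendsto (fun t : ℝ ↦ (γ 0 0 * I + γ 0 1 * (t : ℂ)⁻¹) /
        (γ 1 0 * I + γ 1 1 * (t : ℂ)⁻¹)) atTop (𝓝 ((γ 0 0 * I + γ 0 1 * 0) /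
        (γ 1 0 * I + γ 1 1 * 0))) := by
      refine (tendsto_const_nhds.add (hinv.const_mul _)).div
        (tendsto_const_nhds.add (hinv.const_mul _)) ?_
      rw [h1]
      simp
    have hval : (γ 0 0 * I + γ 0 1 * 0) / (γ 1 0 * I + γ 1 1 * 0) = (((ρ : ℝ)) : ℂ) := by
      rw [h0, h1]
      have := ρ.num_div_den
      have h2 : (ρ.num : ℂ) / ρ.den = (ρ : ℂ) := by exact_mod_cast this
      push_cast
      rw [← h2]
      field_simp
      ring
    rw [hval] at hlim
    refine hlim.congr' ?_
    filter_upwards [eventually_gt_atTop 0] with t ht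
    have : (t : ℂ) ≠ 0 := by exact_mod_cast ht.ne'
    rw [← mul_div_mul_right _ _ this]
    congr 1 <;> field_simp
  · refine tendsto_eisTriangle_I_mul.congr' ?_
    filter_upwards [eventually_gt_atTop 0] with t ht
    rw [hcoe ht, eisTriangle_smul]

end UpperPart

/-! ### Continuation of `Im z > 0` to the whole cut plane -/

section Continuation

/-- The component of `upperPart` that contains the image of the imaginary axis. -/
def mainPart : Set ℂ := connectedComponentIn upperPart (axisS 2 : ℂ)

lemma axisS_two_mem_mainPart : (axisS 2 : ℂ) ∈ mainPart :=
  mem_connectedComponentIn (axisS_mem_upperPart one_lt_two)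

lemma mainPart_subset : mainPart ⊆ upperPart := connectedComponentIn_subset _ _

lemma subset_mainPart {K : Set ℂ} (hK : IsPreconnected K) (hsub : K ⊆ upperPart) {a : ℂ}
    (ha : a ∈ K) (ha' : a ∈ mainPart) : K ⊆ mainPart := by
  rw [mainPart, connectedComponentIn_eq ha']
  exact hK.subset_connectedComponentIn ha hsub

lemma eisTriangle_zMap_of_mem_mainPart {s : ℂ} (hs : s ∈ mainPart) : eisTriangle (zMap s) = s :=
  eisTriangle_zMap_of_preconnected isPreconnected_connectedComponentIn mainPart_subset
    axisS_two_mem_mainPart hs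

/-- No local coordinate can carry a boundary point of `mainPart` to the real line, since the
triangle function has cusps there. -/
lemma not_mem_closure_mainPart_of_im_eq_zero {s₀ : ℂ} (hs₀ : s₀ ∈ cutPlane) {ζ : ℂ → ℂ}
    (hζ : AnalyticAt ℂ ζ s₀) (hζ' : deriv ζ s₀ ≠ 0) (him : (ζ s₀).im = 0)
    (hup : ∀ᶠ s in 𝓝 s₀, 0 < (ζ s).im → s ∈ upperPart)
    (hmain : ∀ᶠ s in 𝓝 s₀, s ∈ mainPart → 0 < (ζ s).im ∧ eisTriangle (ζ s) = s) :
    s₀ ∉ closure mainPart := by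
  intro hcl
  obtain ⟨k, hk, hk0, hkl, hkr⟩ := hζ.exists_analytic_inverse hζ'
  have hkt : Tendsto k (𝓝 (ζ s₀)) (𝓝 s₀) := by
    have := hk.continuousAt.tendsto
    rwa [hk0] at this
  obtain ⟨δ, hδ, hball⟩ := Metric.eventually_nhds_iff_ball.mp <|
    hk.eventually_analyticAt.and <| hkr.and <|
      (hkt.eventually (isOpen_cutPlane.mem_nhds hs₀)).and <| (hkt.eventually hup).and <|
        hkt.eventually hmain
  set G : Set ℂ := Metric.ball (ζ s₀) δ ∩ {z | 0 < z.im} with hG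
  have hGc : IsPreconnected (k '' G) := by
    refine ((convex_ball _ _).inter (convex_halfSpace_im_gt 0)).isPreconnected.image k ?_
    intro w hw
    exact (hball w hw.1).1.continuousAt.continuousWithinAt
  have hGu : k '' G ⊆ upperPart := by
    rintro _ ⟨w, hw, rfl⟩
    obtain ⟨-, h1, -, h2, -⟩ := hball w hw.1
    exact h2 (by rw [h1]; exact hw.2)
  -- The image of the half-disc is connected and lies in `upperPart`. It meets `mainPart` because
  -- `s₀` is a limit point, so it lies in that component.
  have hGm : k '' G ⊆ mainPart := by
    obtain ⟨s, hs, ⟨h1, h2⟩, h3⟩ := ((mem_closure_iff_frequently.mp hcl).and_eventually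
      ((hkl.and hmain).and (hζ.continuousAt.eventually
        (Metric.ball_mem_nhds _ hδ)))).exists
    exact subset_mainPart hGc hGu ⟨ζ s, ⟨h3, (h2 hs).1⟩, h1⟩ hs
  obtain ⟨r, g, hr, hg0, hg, hlim⟩ := exists_tendsto_eisTriangle_zero (ζ s₀).re hδ
  have hrb : (r : ℂ) ∈ Metric.ball (ζ s₀) δ := by
    have : ζ s₀ = ((ζ s₀).re : ℂ) := Complex.ext rfl (by simpa using him)
    rw [Metric.mem_ball, this, dist_eq, ← ofReal_sub, norm_real]
    exact hr
  obtain ⟨h1, -, h3, -, -⟩ := hball _ hrb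
  -- On the half-disc `k` is the triangle function, which tends to `0` at the cusp `r`. By
  -- continuity `k r = 0`, although `k r` is in the cut plane.
  refine ne_zero_of_mem_cutPlane h3
    (tendsto_nhds_unique (h1.continuousAt.tendsto.comp hg) (hlim.congr' ?_))
  filter_upwards [hg0, hg.eventually (Metric.isOpen_ball.mem_nhds hrb)] with t ht htb
  obtain ⟨-, h4, -, -, h5⟩ := hball _ htb
  have := (h5 (hGm ⟨_, ⟨htb, ht⟩, rfl⟩)).2
  rwa [h4] at this

lemma eisTriangle_neg_inv {z : ℂ} (hz : 0 < z.im) : eisTriangle (-z⁻¹) = eisTriangle z := by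
  have h := eisTriangle_smul ModularGroup.S ⟨z, hz⟩
  rw [UpperHalfPlane.modular_S_smul] at h
  simpa [inv_neg] using h

lemma im_neg_inv_pos {z : ℂ} : 0 < (-z⁻¹).im ↔ 0 < z.im := by
  rcases eq_or_ne z 0 with rfl | h
  · simp
  · have := normSq_pos.mpr h
    rw [neg_im, inv_im, neg_div, neg_neg]
    exact ⟨fun h1 ↦ by simpa using (div_pos_iff_of_pos_right this).mp h1, fun h1 ↦ div_pos h1 this⟩

lemma deriv_zMap {s : ℂ} (hs : s ∈ cutPlane) (h : chi₁ s ≠ 0) :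
    deriv zMap s = (chi₁ s * deriv chi₂ s - chi₂ s * deriv chi₁ s) / chi₁ s ^ 2 := by
  have := ((analyticAt_chi₂ hs).differentiableAt.hasDerivAt.div
    (analyticAt_chi₁ hs.2).differentiableAt.hasDerivAt h).deriv
  rw [show zMap = chi₂ / chi₁ from rfl, this]
  ring

/-- By continuity a limit point has `Im z ≥ 0` or `z = ∞`. Real values and `∞` are excluded by the
cusps; if `Im z > 0`, a small ball in `upperPart` joins the point to the component. -/
lemma closure_mainPart_inter_subset : closure mainPart ∩ cutPlane ⊆ mainPart := by
  rintro s₀ ⟨hcl, hs₀⟩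
  have hW := wronskian_ne_zero hs₀
  have h1a := analyticAt_chi₁ hs₀.2
  have h2a := analyticAt_chi₂ hs₀
  by_cases hc : chi₁ s₀ = 0
  · exfalso
    have hc2 : chi₂ s₀ ≠ 0 := fun h ↦ hW (by rw [hc, h]; ring)
    have hζ : ∀ s, -chi₁ s / chi₂ s = -(zMap s)⁻¹ := fun s ↦ by
      rw [zMap, inv_div, neg_div]
    -- A zero of `χ₁` is a pole of `z`. The coordinate `-1/z` moves it to `0`, and the triangle
    -- function is invariant under this substitution.
    refine not_mem_closure_mainPart_of_im_eq_zero hs₀ (ζ := fun s ↦ -chi₁ s / chi₂ s)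
      (h1a.neg.div h2a hc2) ?_ (by simp [hc]) ?_ ?_ hcl
    · have : HasDerivAt (fun s ↦ -chi₁ s / chi₂ s) _ s₀ :=
        h1a.differentiableAt.hasDerivAt.neg.div h2a.differentiableAt.hasDerivAt hc2
      rw [this.deriv]
      refine div_ne_zero ?_ (pow_ne_zero 2 hc2)
      convert hW using 1
      simp only [Pi.neg_apply]
      ring
    · filter_upwards [isOpen_cutPlane.mem_nhds hs₀] with s hs hpos
      rw [hζ, im_neg_inv_pos] at hpos
      refine ⟨hs, fun h ↦ ?_, hpos⟩
      simp [zMap, h] at hpos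
    · refine .of_forall fun s hs ↦ ?_
      have hz := (mainPart_subset hs).2.2
      rw [hζ, im_neg_inv_pos, eisTriangle_neg_inv hz]
      exact ⟨hz, eisTriangle_zMap_of_mem_mainPart hs⟩
  · have hza := analyticAt_zMap hs₀ hc
    rcases lt_trichotomy (zMap s₀).im 0 with him | him | him
    · exfalso
      obtain ⟨s, hs, h⟩ := ((mem_closure_iff_frequently.mp hcl).and_eventually
        ((continuous_im.continuousAt.comp hza.continuousAt).eventually
          (gt_mem_nhds him))).exists
      exact lt_asymm h (mainPart_subset hs).2.2
    · refine absurd hcl (not_mem_closure_mainPart_of_im_eq_zero hs₀ hza ?_ him ?_ ?_)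
      · rw [deriv_zMap hs₀ hc]
        exact div_ne_zero hW (pow_ne_zero 2 hc)
      · filter_upwards [isOpen_cutPlane.mem_nhds hs₀, h1a.continuousAt.eventually_ne hc]
          with s hs h hpos
        exact ⟨hs, h, hpos⟩
      · exact .of_forall fun s hs ↦
          ⟨(mainPart_subset hs).2.2, eisTriangle_zMap_of_mem_mainPart hs⟩
    · obtain ⟨ε, hε, hball⟩ := Metric.eventually_nhds_iff_ball.mp
        (eventually_mem_upperPart ⟨hs₀, hc, him⟩)
      obtain ⟨s, hs, h⟩ := ((mem_closure_iff_frequently.mp hcl).and_eventually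
        (Metric.ball_mem_nhds s₀ hε)).exists
      exact subset_mainPart (convex_ball s₀ ε).isPreconnected hball h hs (Metric.mem_ball_self hε)

/-- On the whole doubly cut plane `χ₁` does not vanish and `z(s)` lies in the upper half-plane. -/
theorem cutPlane_subset_upperPart : cutPlane ⊆ upperPart := by
  refine Set.Subset.trans ?_ mainPart_subset
  exact isPreconnected_cutPlane.subset_of_closure_inter_subset
    isOpen_upperPart.connectedComponentIn
    ⟨_, axisS_mem_cutPlane one_lt_two, axisS_two_mem_mainPart⟩ closure_mainPart_inter_subset

lemma eisQ_zMap {s : ℂ} (hs : s ∈ cutPlane) : eisQ (zMap s) = chi₁ s ^ 4 :=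
  eisQ_zMap_of_preconnected isPreconnected_cutPlane cutPlane_subset_upperPart
    (axisS_mem_cutPlane one_lt_two) hs

lemma eisR_zMap {s : ℂ} (hs : s ∈ cutPlane) :
    eisR (zMap s) = (1 - s) ^ (1 / 2 : ℂ) * chi₁ s ^ 6 :=
  eisR_zMap_of_preconnected isPreconnected_cutPlane cutPlane_subset_upperPart
    (axisS_mem_cutPlane one_lt_two) hs

lemma eisP_zMap {s : ℂ} (hs : s ∈ cutPlane) :
    eisP (zMap s) =
      (1 - s) ^ (1 / 2 : ℂ) * (chi₁ s ^ 2 + 12 * s * chi₁ s * deriv chi₁ s) :=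
  eisP_zMap_of_preconnected isPreconnected_cutPlane cutPlane_subset_upperPart
    (axisS_mem_cutPlane one_lt_two) hs

lemma eisTriangle_zMap {s : ℂ} (hs : s ∈ cutPlane) : eisTriangle (zMap s) = s :=
  eisTriangle_zMap_of_preconnected isPreconnected_cutPlane cutPlane_subset_upperPart
    (axisS_mem_cutPlane one_lt_two) hs

end Continuation

/-! ### The limits of `z(s)` at `s = 0` and `s = 1` -/

section Normalization

lemma analyticAt_nomeTriangle_zero : AnalyticAt ℂ nomeTriangle 0 := by
  have hb : Metric.ball (0 : ℂ) 1 ∈ 𝓝 0 := Metric.ball_mem_nhds _ one_pos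
  have hQ := differentiableOn_ramanujanQ.analyticAt hb
  have hR := differentiableOn_ramanujanR.analyticAt hb
  have hQ0 : ramanujanQ 0 = 1 := by simp [ramanujanQ_eq, lambertSeries_zero]
  exact ((hQ.pow 3).sub (hR.pow 2)).div (hQ.pow 3) (by simp [hQ0])

/-- Near `s = 0` the nome `q = exp (2πi z(s))` is the local inverse of `(Q³ - R²) / Q³`. -/
lemma tendsto_exp_zMap_zero :
    Tendsto (fun s ↦ exp (2 * Real.pi * I * zMap s)) (𝓝[cutPlane] 0) (𝓝 0) := by
  obtain ⟨κ, hκ, hκ0, hκl, -⟩ := analyticAt_nomeTriangle_zero.exists_analytic_inverse (by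
    rw [hasDerivAt_nomeTriangle_zero.deriv]
    norm_num)
  rw [nomeTriangle_zero] at hκ hκ0
  obtain ⟨ε, hε, hball⟩ := Metric.eventually_nhds_iff_ball.mp hκ.eventually_analyticAt
  have haxis : Tendsto (fun y ↦ (axisS y : ℂ)) atTop (𝓝 0) := by
    have := (continuous_ofReal.tendsto 0).comp tendsto_axisS_atTop
    rwa [ofReal_zero] at this
  obtain ⟨Y, hY⟩ := eventually_atTop.mp <| (haxis.eventually (Metric.ball_mem_nhds 0 hε)).and
    (tendsto_exp_two_pi_I_mul_I_mul.eventually hκl)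
  have h1 : 1 < max Y 1 + 1 := by linarith [le_max_right Y 1]
  have hmem := (hY (max Y 1 + 1) (by linarith [le_max_left Y 1])).1
  have heq : Set.EqOn (fun s ↦ exp (2 * Real.pi * I * zMap s)) κ
      (cutPlane ∩ Metric.ball 0 ε) := by
    refine eqOn_of_eq_axisS (fun s hs ↦ ?_) (fun s hs ↦ hball s hs.2)
      (isPreconnected_cutPlane_inter_ball (axisS_pos h1) (axisS_lt_one h1) hmem) h1
      ⟨axisS_mem_cutPlane h1, hmem⟩ ?_
    · have := analyticAt_zMap hs.1 (cutPlane_subset_upperPart hs.1).2.1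
      fun_prop
    · have hYlt : Y < max Y 1 + 1 := by linarith [le_max_left Y 1]
      filter_upwards [lt_mem_nhds h1, lt_mem_nhds hYlt] with y hy hy'
      have h2 := (hY y hy'.le).2
      rw [← eisTriangle_eq, eisTriangle_I_mul (one_pos.trans hy)] at h2
      rw [zMap_axisS hy, h2]
  have hlim : Tendsto κ (𝓝[cutPlane] 0) (𝓝 0) := by
    have := hκ.continuousAt.tendsto
    rw [hκ0] at this
    exact this.mono_left nhdsWithin_le_nhds
  refine hlim.congr' ?_
  filter_upwards [self_mem_nhdsWithin,
    mem_nhdsWithin_of_mem_nhds (Metric.ball_mem_nhds 0 hε)] with s hs hs'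
  exact (heq ⟨hs, hs'⟩).symm

theorem tendsto_zMap_im_zero : Tendsto (fun s ↦ (zMap s).im) (𝓝[cutPlane] 0) atTop := by
  have h1 := tendsto_exp_zMap_zero.norm
  have h2 : Tendsto (fun s ↦ ‖exp (2 * Real.pi * I * zMap s)‖) (𝓝[cutPlane] 0) (𝓝[>] 0) := by
    refine tendsto_nhdsWithin_iff.mpr ⟨by simpa using h1, .of_forall fun s ↦ ?_⟩
    exact norm_pos_iff.mpr (exp_ne_zero _)
  -- `Im z = -log |q| / (2π)`, and `q → 0` through nonzero values.
  have h3 := (tendsto_neg_atBot_atTop.comp (Real.tendsto_log_nhdsGT_zero.comp h2)).const_mul_atTop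
    (inv_pos.mpr Real.two_pi_pos)
  refine h3.congr fun s ↦ ?_
  have := Real.two_pi_pos.ne'
  simp only [Function.comp_apply, norm_exp, Real.log_exp]
  simp
  field_simp

/-- The square root of `1 - s` as a function of `z`, near `z = i`. -/
noncomputable def eisW (z : ℂ) : ℂ := eisR z / (eisQ z ^ (1 / 2 : ℂ) * eisQ z)

lemma eisW_I_mul {y : ℝ} (hy : 0 < y) : eisW (I * y) = axisW y := by
  have hU := axisU_pos hy
  have hU' : (axisU y : ℂ) ≠ 0 := by exact_mod_cast hU.ne'
  have h : (axisQ y : ℂ) ^ (1 / 2 : ℂ) = axisU y ^ 2 := by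
    rw [← axisU_pow_four hy, show (1 / 2 : ℂ) = ((1 / 2 : ℝ) : ℂ) by push_cast; rfl,
      ← ofReal_cpow (by positivity), ← Real.sqrt_eq_rpow,
      show axisU y ^ 4 = (axisU y ^ 2) ^ 2 by ring, Real.sqrt_sq (by positivity)]
    push_cast
    rfl
  rw [eisW, eisQ_I_mul, eisR_I_mul, h, axisR_eq_mul hy, ← axisU_pow_four hy]
  push_cast
  field_simp

lemma eisQ_I_mem_slitPlane : eisQ I ∈ slitPlane := by
  have h := eisQ_I_mul 1
  rw [ofReal_one, mul_one] at h
  rw [h, ofReal_mem_slitPlane]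
  exact one_pos.trans (one_lt_axisQ one_pos)

lemma analyticAt_eisW_I : AnalyticAt ℂ eisW I := by
  have hI : 0 < I.im := by simp
  have hQ := eisQ_I_mem_slitPlane
  have h0 := slitPlane_ne_zero hQ
  exact (analyticAt_eisR hI).div (((analyticAt_eisQ hI).cpow analyticAt_const hQ).mul
    (analyticAt_eisQ hI)) (mul_ne_zero (cpow_half_ne_zero h0) h0)

lemma eisW_I : eisW I = 0 := by simp [eisW, eisR_I]

/-- As `R(i) = 0`, only `R'(i) = -πi Q(i)²` contributes, and `Q(i) ≠ 0`. So `R / Q^{3/2}` is a local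
coordinate at `i`, which `1 - s`, its square, is not. -/
lemma deriv_eisW_I_ne_zero : deriv eisW I ≠ 0 := by
  have hI : 0 < I.im := by simp
  have hQ := eisQ_I_mem_slitPlane
  have h0 := slitPlane_ne_zero hQ
  have hden := mul_ne_zero (cpow_half_ne_zero h0) h0
  have h : HasDerivAt eisW _ I := (hasDerivAt_eisR hI).div
    (((analyticAt_eisQ hI).cpow (analyticAt_const (v := (1 / 2 : ℂ))) hQ).mul
      (analyticAt_eisQ hI)).differentiableAt.hasDerivAt hden
  rw [h.deriv, eisR_I]
  refine div_ne_zero ?_ (pow_ne_zero 2 hden)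
  rw [zero_mul, sub_zero]
  refine mul_ne_zero (mul_ne_zero two_pi_I_ne_zero ?_) hden
  simpa using h0

/-- Near `s = 1`, `z(s)` is a holomorphic function of `(1 - s) ^ (1 / 2)`. -/
theorem tendsto_zMap_one : Tendsto zMap (𝓝[cutPlane] 1) (𝓝 I) := by
  obtain ⟨k, hk, hk0, hkl, -⟩ := analyticAt_eisW_I.exists_analytic_inverse deriv_eisW_I_ne_zero
  rw [eisW_I] at hk hk0
  have hroot : Tendsto (fun s : ℂ ↦ (1 - s) ^ (1 / 2 : ℂ)) (𝓝 1) (𝓝 0) := by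
    have h1 : ContinuousAt (fun s : ℂ ↦ (1 - s) ^ (1 / 2 : ℂ)) 1 :=
      ContinuousAt.comp (g := fun x : ℂ ↦ x ^ (1 / 2 : ℂ)) (f := fun s : ℂ ↦ 1 - s)
        (continuousAt_cpow_const_of_re_pos (by simp) (by norm_num)) (by fun_prop)
    simpa using h1.tendsto
  obtain ⟨ε, hε, hball⟩ := Metric.eventually_nhds_iff_ball.mp
    (hroot.eventually hk.eventually_analyticAt)
  have haxis : Tendsto (fun y ↦ (axisS y : ℂ)) (𝓝 1) (𝓝 1) := by
    have := (hasDerivAt_axisS one_pos).ofReal_comp.continuousAt.tendsto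
    rwa [axisS_one, ofReal_one] at this
  have hI : Tendsto (fun y : ℝ ↦ I * (y : ℂ)) (𝓝 1) (𝓝 I) := by
    have : Continuous fun y : ℝ ↦ I * (y : ℂ) := by fun_prop
    simpa using this.tendsto 1
  have hev := ((haxis.eventually (Metric.ball_mem_nhds 1 hε)).and
    (hI.eventually hkl).eventually_nhds).filter_mono (nhdsWithin_le_nhds (s := Set.Ioi 1))
  obtain ⟨y₀, ⟨hmem, hnear⟩, h1 : 1 < y₀⟩ := (hev.and self_mem_nhdsWithin).exists
  have heq : Set.EqOn zMap (fun s ↦ k ((1 - s) ^ (1 / 2 : ℂ))) (cutPlane ∩ Metric.ball 1 ε) := by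
    refine eqOn_of_eq_axisS (fun s hs ↦ ?_) (fun s hs ↦ ?_)
      (isPreconnected_cutPlane_inter_ball (axisS_pos h1) (axisS_lt_one h1) hmem) h1
      ⟨axisS_mem_cutPlane h1, hmem⟩ ?_
    · exact analyticAt_zMap hs.1 (cutPlane_subset_upperPart hs.1).2.1
    · exact AnalyticAt.comp (g := k) (hball s hs.2) (analyticAt_one_sub_cpow_half hs.1.2)
    · filter_upwards [lt_mem_nhds h1, hnear] with y hy hy'
      rw [zMap_axisS hy, one_sub_axisS_cpow hy, ← eisW_I_mul (one_pos.trans hy), hy']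
  have hlim : Tendsto (fun s ↦ k ((1 - s) ^ (1 / 2 : ℂ))) (𝓝[cutPlane] 1) (𝓝 I) := by
    have := hk.continuousAt.tendsto.comp hroot
    rw [hk0] at this
    exact this.mono_left nhdsWithin_le_nhds
  refine hlim.congr' ?_
  filter_upwards [self_mem_nhdsWithin,
    mem_nhdsWithin_of_mem_nhds (Metric.ball_mem_nhds 1 hε)] with s hs hs'
  exact (heq ⟨hs, hs'⟩).symm

end Normalization

/-! ### The triangle function: existence, poles and uniqueness -/

lemma IsAxisSolution.isHypergeometricSolution {φ : ℂ → ℂ} (h : IsAxisSolution φ) :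
    IsHypergeometricSolution 0 (1 / 2) (1 / 3) φ := by
  refine ⟨fun s hs ↦ (h.analyticAt s hs).differentiableAt.differentiableWithinAt,
    fun s hs ↦ ?_⟩
  have h0 := ne_zero_of_mem_cutPlane hs
  have h1 : 1 - s ≠ 0 := slitPlane_ne_zero hs.2
  have h2 : s - 1 ≠ 0 := fun h ↦ h1 (by linear_combination -h)
  have hode := h.ode s hs
  field_simp
  -- For the exponent differences `0, 1/2, 1/3` the last coefficient has numerator `(1/4 - 1/9)/4 =
  -- 5/144 = (1/12)(5/12)`.
  linear_combination -144 * hode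

lemma IsAxisSolution.const_mul_add {φ ψ : ℂ → ℂ} (hφ : IsAxisSolution φ)
    (hψ : IsAxisSolution ψ) (a b : ℂ) : IsAxisSolution fun s ↦ a * φ s + b * ψ s where
  analyticAt s hs := by
    have h1 := hφ.analyticAt s hs
    have h2 := hψ.analyticAt s hs
    fun_prop
  ode s hs := by
    have hd (t : ℂ) (ht : t ∈ cutPlane) :
        deriv (fun s ↦ a * φ s + b * ψ s) t = a * deriv φ t + b * deriv ψ t :=
      (((hφ.analyticAt t ht).differentiableAt.hasDerivAt.const_mul a).add
        ((hψ.analyticAt t ht).differentiableAt.hasDerivAt.const_mul b)).deriv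
    have hdd : deriv (deriv fun s ↦ a * φ s + b * ψ s) s =
        a * deriv (deriv φ) s + b * deriv (deriv ψ) s := by
      have he : (deriv fun s ↦ a * φ s + b * ψ s) =ᶠ[𝓝 s]
          fun t ↦ a * deriv φ t + b * deriv ψ t := by
        filter_upwards [isOpen_cutPlane.mem_nhds hs] with t ht using hd t ht
      rw [he.deriv_eq]
      exact (((hφ.analyticAt s hs).deriv.differentiableAt.hasDerivAt.const_mul a).add
        ((hψ.analyticAt s hs).deriv.differentiableAt.hasDerivAt.const_mul b)).deriv
    rw [hd s hs, hdd]
    linear_combination a * hφ.ode s hs + b * hψ.ode s hs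

lemma isAxisSolution_chi₂ : IsAxisSolution chi₂ :=
  isAxisSolution_chiHalf_one_sub.const_mul_add isAxisSolution_chi₁ constA constB

lemma analyticAt_eisTriangle_inv {z : ℂ} (hz : 0 < z.im) : AnalyticAt ℂ eisTriangle⁻¹ z := by
  have h : eisTriangle⁻¹ = fun z ↦ eisQ z ^ 3 / (eisQ z ^ 3 - eisR z ^ 2) := by
    ext z
    simp [eisTriangle]
  rw [h]
  have hQ := analyticAt_eisQ hz
  have hR := analyticAt_eisR hz
  exact (hQ.pow 3).div ((hQ.pow 3).sub (hR.pow 2)) (eisQ_cube_sub_eisR_sq_ne_zero hz)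

/-- Normal form passes to inverses. At a zero of `Q` the convention `x / 0 = 0` gives exactly the
value that normal form prescribes at a pole. -/
lemma meromorphicNFAt_eisTriangle {z : ℂ} (hz : 0 < z.im) : MeromorphicNFAt eisTriangle z :=
  meromorphicNFAt_inv.mp (analyticAt_eisTriangle_inv hz).meromorphicNFAt

lemma isTriangleFunction_eisTriangle :
    IsTriangleFunction 0 (1 / 2) (1 / 3) chi₁ chi₂ eisTriangle where
  solution₁ := isAxisSolution_chi₁.isHypergeometricSolution
  solution₂ := isAxisSolution_chi₂.isHypergeometricSolution
  independent _ hs := wronskian_ne_zero hs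
  meromorphic _ hz := meromorphicNFAt_eisTriangle hz
  mapsTo _ hs := (cutPlane_subset_upperPart hs).2
  inverse _ hs := eisTriangle_zMap hs

lemma isPreconnected_im_pos : IsPreconnected {z : ℂ | 0 < z.im} :=
  (convex_halfSpace_im_gt 0).isPreconnected

lemma analyticAt_eisTriangle {z : ℂ} (hz : 0 < z.im) (hQ : eisQ z ≠ 0) :
    AnalyticAt ℂ eisTriangle z :=
  (((analyticAt_eisQ hz).pow 3).sub ((analyticAt_eisR hz).pow 2)).div
    ((analyticAt_eisQ hz).pow 3) (pow_ne_zero 3 hQ)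

lemma meromorphicOrderAt_eisTriangle_ne_top {z : ℂ} (hz : 0 < z.im) :
    meromorphicOrderAt eisTriangle z ≠ ⊤ := by
  have h2 : 0 < (I * ((2 : ℝ) : ℂ)).im := by simp
  refine MeromorphicOn.meromorphicOrderAt_ne_top_of_isPreconnected
    (fun w hw ↦ (meromorphicNFAt_eisTriangle hw).meromorphicAt) isPreconnected_im_pos h2 hz ?_
  rw [(meromorphicNFAt_eisTriangle h2).meromorphicOrderAt_eq_zero_iff.mpr]
  · simp
  · rw [eisTriangle_I_mul two_pos]
    exact_mod_cast (axisS_pos one_lt_two).ne'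

lemma meromorphicOrderAt_eisTriangle_neg {z : ℂ} (hz : 0 < z.im) (hQ : eisQ z = 0) :
    meromorphicOrderAt eisTriangle z < 0 := by
  by_contra! h
  have h1 := meromorphicOrderAt_eisTriangle_ne_top hz
  -- In normal form, order `0` would mean a nonzero value, but division by `Q = 0` returns `0`.
  -- Positive order is excluded because the reciprocal is analytic.
  have h2 : meromorphicOrderAt eisTriangle z ≠ 0 := fun h0 ↦
    (meromorphicNFAt_eisTriangle hz).meromorphicOrderAt_eq_zero_iff.mp h0 (by
      simp [eisTriangle, hQ])
  have h3 := (analyticAt_eisTriangle_inv hz).meromorphicOrderAt_nonneg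
  rw [meromorphicOrderAt_inv] at h3
  lift meromorphicOrderAt eisTriangle z to ℤ using h1 with n
  norm_cast at h h2 h3
  omega

/-- The triangle function is determined by its values on the imaginary axis. -/
lemma IsTriangleFunction.eventuallyEq_eisTriangle {S : ℂ → ℂ}
    (hS : IsTriangleFunction 0 (1 / 2) (1 / 3) chi₁ chi₂ S) {z : ℂ} (hz : 0 < z.im) :
    S =ᶠ[𝓝 z] eisTriangle := by
  -- Two normal forms that agree on a punctured neighbourhood agree at the centre too, so only the
  -- equality of meromorphic germs is at stake. It propagates from `2i`, where both functions invert
  -- `z(s)` along the axis.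
  refine (MeromorphicNFAt.eventuallyEq_nhdsNE_iff_eventuallyEq_nhds (hS.meromorphic hz)
    (meromorphicNFAt_eisTriangle hz)).mp ?_
  have hmer : MeromorphicOn (S - eisTriangle) {z : ℂ | 0 < z.im} := fun w hw ↦
    (hS.meromorphic hw).meromorphicAt.sub (meromorphicNFAt_eisTriangle hw).meromorphicAt
  have h2 : 0 < (I * ((2 : ℝ) : ℂ)).im := by simp
  have htop : meromorphicOrderAt (S - eisTriangle) (I * ((2 : ℝ) : ℂ)) = ⊤ := by
    refine meromorphicOrderAt_eq_top_iff.mpr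
      ((hmer _ h2).frequently_zero_iff_eventuallyEq_zero.mp ?_)
    have hd : HasDerivAt (fun y : ℝ ↦ I * (y : ℂ)) (I * 1) 2 :=
      ((hasDerivAt_id (2 : ℝ)).ofReal_comp).const_mul I
    refine (hd.tendsto_nhdsNE (by simp)).frequently (Eventually.frequently ?_)
    filter_upwards [nhdsWithin_le_nhds (lt_mem_nhds one_lt_two)] with y hy
    have h := hS.inverse _ (axisS_mem_cutPlane hy)
    rw [← zMap, zMap_axisS hy] at h
    rw [Pi.sub_apply, h, eisTriangle_I_mul (one_pos.trans hy), sub_self]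
  have hz' : meromorphicOrderAt (S - eisTriangle) z = ⊤ := by
    by_contra h
    exact hmer.meromorphicOrderAt_ne_top_of_isPreconnected isPreconnected_im_pos hz h2 h htop
  filter_upwards [meromorphicOrderAt_eq_top_iff.mp hz'] with w hw
  exact sub_eq_zero.mp hw

theorem proposition2 :
    -- the hypergeometric functions are the principal branches on `ℂ ∖ [1, ∞)`
    IsHypergeometricBranch (1 / 12) (5 / 12) 1 chi₁ ∧
    IsHypergeometricBranch (1 / 12) (5 / 12) (1 / 2)
      (hypergeometricBranch (1 / 12) (5 / 12) (1 / 2)) ∧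
    -- the normalization of `z(s)`: `z(0) = i∞` and `z(1) = i`
    Tendsto (fun s => (zMap s).im) (𝓝[cutPlane] 0) atTop ∧
    Tendsto zMap (𝓝[cutPlane] 1) (𝓝 I) ∧
    -- the parametrization of `P`, `Q`, `R`
    (∀ s ∈ cutPlane, ∀ q : ℂ, q = exp (2 * Real.pi * I * zMap s) →
      ‖q‖ < 1 ∧
      ramanujanP q = (1 - s) ^ (1 / 2 : ℂ) * (chi₁ s ^ 2 + 12 * s * chi₁ s * deriv chi₁ s) ∧
      ramanujanQ q = chi₁ s ^ 4 ∧
      ramanujanR q = (1 - s) ^ (1 / 2 : ℂ) * chi₁ s ^ 6 ∧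
      chi₁ s ≠ 0 ∧
      s = (ramanujanQ q ^ 3 - ramanujanR q ^ 2) / ramanujanQ q ^ 3) ∧
    -- the triangle function `S(0, 1/2, 1/3; z)`, the inverse of `z(s)`, on the upper half-plane
    (∃ S, IsTriangleFunction 0 (1 / 2) (1 / 3) chi₁ chi₂ S) ∧
    (∀ S, IsTriangleFunction 0 (1 / 2) (1 / 3) chi₁ chi₂ S →
      ∀ z : ℂ, 0 < z.im → ∀ q : ℂ, q = exp (2 * Real.pi * I * z) →
        (ramanujanQ q ≠ 0 → AnalyticAt ℂ S z ∧
          S z = (ramanujanQ q ^ 3 - ramanujanR q ^ 2) / ramanujanQ q ^ 3) ∧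
        (ramanujanQ q = 0 → meromorphicOrderAt S z < 0)) := by
  refine ⟨isHypergeometricBranch_chi₁, isHypergeometricBranch_chiHalf, tendsto_zMap_im_zero,
    tendsto_zMap_one, ?_, ⟨_, isTriangleFunction_eisTriangle⟩, ?_⟩
  · rintro s hs q rfl
    obtain ⟨-, hne, him⟩ := cutPlane_subset_upperPart hs
    exact ⟨norm_exp_two_pi_I_mul_lt_one him, eisP_zMap hs, eisQ_zMap hs, eisR_zMap hs, hne,
      (eisTriangle_zMap hs).symm⟩
  · rintro S hS z hz q rfl
    have he := hS.eventuallyEq_eisTriangle hz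
    refine ⟨fun hQ ↦ ⟨(analyticAt_eisTriangle hz hQ).congr he.symm, he.eq_of_nhds⟩, fun hQ ↦ ?_⟩
    rw [meromorphicOrderAt_congr (he.filter_mono nhdsWithin_le_nhds)]
    exact meromorphicOrderAt_eisTriangle_neg hz hQ
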